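/- **Proposition 3.2.** Let $K$ be a field of characteristic zero (for example $\mathbb C$, or $\mathbb Q(q,t^{1/2})$) and let $q,t\in K$, $t\neq 0$, have the property that $q^n\neq 1$ and $t^n\neq 1$ for all $n\ge 1$; fix a square root $t^{1/2}\in K$. All functions below are formal power series in formal variables; no condition such as $|t|<1$ is imposed. Let $p_n=p_n(x)$ and $p_n(y)$ ($n\ge 1$) be the power sums of two independent sets of variables $x$ and $y$, regarded as independent formal variables, and regard symmetric functions in $x$ as polynomials in the $p_n(x)$. For values $p=(p_n)_{n\ge1}$ of the power sums, define $e_r$ by $$\sum_{r\ge 0}(-w)^r e_r=\exp\Big(-\sum_{n>0}\frac{p_n w^n}{n}\Big),$$ and put $p_n(t^{\rho})=\dfrac{1}{t^{n/2}-t^{-n/2}}$, $\;p_n(t^{-\rho})=\dfrac{1}{t^{-n/2}-t^{n/2}}$, $\;p_n(y,t^{-\rho})=p_n(y)+p_n(t^{-\rho})$; then $e_r(t^\rho)$ and $e_r(y,t^{-\rho})$ denote $e_r$ at these values of the power sums. Let $$\Pi(x,y;q,t)=\exp\Big(\sum_{n>0}\frac1n\,\frac{1-t^n}{1-q^n}\,p_n(x)p_n(y)\Big),\qquad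 \Delta(z;u)=\exp\Big(-\sum_{n>0}\frac{1-u^n}{n}\sum_{1\le\alpha<\beta\le r}\frac{z_\alpha^n}{z_\beta^n}\Big),$$ and for $r\ge 0$ let $H^r=H^r(x)$ be the operator on symmetric functions in $x$ (extended coefficientwise to power series in the $p_n(y)$) $$H^r=e_r(t^\rho)\oint\prod_{\alpha=1}^r\frac{dz_\alpha}{2\pi i z_\alpha}\;\Delta(z;t^{-1})\, \exp\Big(\sum_{n>0}\frac{1-t^{-n}}{n}\sum_{\alpha=1}^r z_\alpha^n\,p_n\Big) \exp\Big(\sum_{n>0}(q^n-1)\sum_{\alpha=1}^r z_\alpha^{-n}\frac{\partial}{\partial p_n}\Big),$$ where $\oint\prod_\alpha\frac{dz_\alpha}{2\pi i z_\alpha}$ takes the constant term in the formal variables $z_1,\dots,z_r$ and $\Delta(z;t^{-1})$ is expanded in the ratios $z_\alpha/z_\beta$, $\alpha<\beta$; in particular $H^0=1$. Then for every $r\ge 0$, as formal power series in the $p_n(y)$, $$\left.\frac{H^r(x)\,\Pi(x,y;q,t)}{\Pi(x,y;q,t)}\right|_{x=t^{-\rho}}=(-1)^r\,t^{-r(r-1)/2}\,e_r(y,t^{-\rho}),$$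 where $x=t^{-\rho}$ means the substitution $p_n(x)\mapsto p_n(t^{-\rho})$ for all $n\ge1$. -/

import Mathlib

noncomputable section

namespace Mac

/-! Throughout, `K` is a field of characteristic zero; the ring of symmetric functions is the
polynomial ring over `K` in the power sums `p₁, p₂, …`. -/

/-- Symmetric functions in `x`, as polynomials in the power sums `p n = p_n(x)`, `n ≥ 1`. -/
abbrev SymF (K : Type*) [CommRing K] := MvPolynomial ℕ+ K

/-- The power series `∑_{n ≥ 1} c n * w ^ n` in one variable `w` (no constant term). -/
def sumPos {A : Type*} [CommRing A] (c : ℕ+ → A) : PowerSeries A :=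
  PowerSeries.mk fun n => if h : 0 < n then c ⟨n, h⟩ else 0

lemma constantCoeff_sumPos {A : Type*} [CommRing A] (c : ℕ+ → A) :
    PowerSeries.constantCoeff (sumPos c) = 0 := by
  rw [← PowerSeries.coeff_zero_eq_constantCoeff_apply, sumPos, PowerSeries.coeff_mk]
  simp

/-! ### Elementary symmetric functions and the specialization `t ^ (± ρ)` -/

/-- `e_r` as a function of the values `p n` of the power sums, through
`∑_r (-w)^r e_r = exp (- ∑_{n ≥ 1} p_n w^n / n)`. -/
def elem {A : Type*} [CommRing A] [Algebra ℚ A] (p : ℕ+ → A) (r : ℕ) : A :=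
  (-1) ^ r * PowerSeries.coeff r
    ((PowerSeries.exp A).subst (sumPos fun n => -(algebraMap ℚ A (1 / (n : ℚ)) * p n)))

/-- `p_n(t^ρ) = 1 / (t^{n/2} - t^{-n/2})`, where `th` stands for `t^{1/2}`. -/
def pRho {K : Type*} [Field K] (th : K) (n : ℕ+) : K :=
  1 / (th ^ (n : ℕ) - (th ^ (n : ℕ))⁻¹)

/-- `p_n(t^{-ρ}) = 1 / (t^{-n/2} - t^{n/2})`, where `th` stands for `t^{1/2}`. -/
def pNegRho {K : Type*} [Field K] (th : K) (n : ℕ+) : K :=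
  1 / ((th ^ (n : ℕ))⁻¹ - th ^ (n : ℕ))

section ZSeries

variable (K : Type*) [Field K] (r : ℕ)

/-- Formal Laurent series in `z_0, …, z_{r-1}` with coefficients in the ring of symmetric functions:
exponents are `r`-tuples of integers, ordered lexicographically, and supports are well-ordered.
This ring contains the power series in the `z_α`, the polynomials in the `z_α⁻¹`
and the power series in the `z_α / z_β` with `α < β`. -/
abbrev ZSeries := HahnSeries (Lex (Fin r → ℤ)) (SymF K)

variable {K r}

/-- The monomial `z_α ^ k`, `k ∈ ℤ`. -/
def zpw (α : Fin r) (k : ℤ) : ZSeries K r :=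
  HahnSeries.single (toLex (Pi.single α k)) 1

/-- The monomial `z_α / z_β`. -/
def zratio (α β : Fin r) : ZSeries K r :=
  HahnSeries.single (toLex (Pi.single α 1 - Pi.single β 1)) 1

lemma zpw_mul_zpw (α β : Fin r) : (zpw α 1 * zpw β (-1) : ZSeries K r) = zratio α β := by
  rw [zpw, zpw, zratio, HahnSeries.single_mul_single, one_mul, ← toLex_add, Pi.single_neg,
    sub_eq_add_neg]

/-- The exponential of a formal series of positive order. -/
def zexp [CharZero K] (F : ZSeries K r) : ZSeries K r :=
  PowerSeries.heval F (PowerSeries.exp (SymF K))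

/-- The constant term `∮ ∏_α dz_α / (2πi z_α) F`. -/
def constTerm (F : ZSeries K r) : SymF K := F.coeff 0

lemma zpw_order_pos (α : Fin r) : 0 < (zpw α 1 : ZSeries K r).orderTop := by
  rw [zpw, HahnSeries.orderTop_single one_ne_zero, ← WithTop.coe_zero, WithTop.coe_lt_coe]
  refine ⟨α, fun j hj => ?_, ?_⟩
  · change (0 : ℤ) = Pi.single (M := fun _ => ℤ) α 1 j
    simp [Pi.single_eq_of_ne hj.ne]
  · change (0 : ℤ) < Pi.single (M := fun _ => ℤ) α 1 α
    simp

lemma zratio_order_pos {α β : Fin r} (h : α < β) :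
    0 < (zratio α β : ZSeries K r).orderTop := by
  rw [zratio, HahnSeries.orderTop_single one_ne_zero, ← WithTop.coe_zero, WithTop.coe_lt_coe]
  refine ⟨α, fun j hj => ?_, ?_⟩
  · change (0 : ℤ) = Pi.single (M := fun _ => ℤ) α 1 j - Pi.single (M := fun _ => ℤ) β 1 j
    simp [Pi.single_eq_of_ne hj.ne, Pi.single_eq_of_ne (lt_trans hj h).ne]
  · change (0 : ℤ) < Pi.single (M := fun _ => ℤ) α 1 α - Pi.single (M := fun _ => ℤ) β 1 α
    simp [Pi.single_eq_of_ne h.ne]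

/-- `∑_{n ≥ 1} c n * w ^ n` for a Laurent series `w` of positive order. -/
def zsum (c : ℕ+ → SymF K) (w : ZSeries K r) : ZSeries K r :=
  PowerSeries.heval w (sumPos c)

/-- `Δ(z; u) = exp (- ∑_{n ≥ 1} (1 - u^n) / n * ∑_{α < β} z_α^n / z_β^n)`. -/
def Delta [CharZero K] (r : ℕ) (u : K) : ZSeries K r :=
  zexp (-∑ α : Fin r, ∑ β ∈ Finset.Ioi α,
    zsum (fun n => MvPolynomial.C ((1 - u ^ (n : ℕ)) / (n : K))) (zratio α β))

/-- `φ₊(z) = exp (∑_{n ≥ 1} (1 - t^{-n}) / n * ∑_α z_α^n * p_n)`, acting by multiplication. -/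
def phiPlus [CharZero K] (r : ℕ) (t : K) : ZSeries K r :=
  zexp (∑ α : Fin r,
    zsum (fun n => MvPolynomial.C ((1 - (t ^ (n : ℕ))⁻¹) / (n : K)) * MvPolynomial.X n) (zpw α 1))

/-- The derivation `∑_{n ≥ 1} (q^n - 1) * ∑_α u_α^n * ∂/∂p_n` of the polynomial ring in the power
sums `p_n` (indexed by `Sum.inl n`) and in the variables `u_α = z_α⁻¹` (indexed by `Sum.inr α`). -/
def phiDer (r : ℕ) (q : K) :
    Derivation K (MvPolynomial (ℕ+ ⊕ Fin r) K) (MvPolynomial (ℕ+ ⊕ Fin r) K) :=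
  MvPolynomial.mkDerivation K (Sum.elim
    (fun n => MvPolynomial.C (q ^ (n : ℕ) - 1) *
      ∑ α : Fin r, MvPolynomial.X (Sum.inr α) ^ (n : ℕ))
    (fun _ => 0))

lemma iterate_mul_eq_zero {A : Type*} [CommRing A] [Algebra K A] (D : Derivation K A A) :
    ∀ (m n : ℕ) (F G : A), D^[m + 1] F = 0 → D^[n + 1] G = 0 → D^[m + n + 1] (F * G) = 0 := by
  have hadd : ∀ (k : ℕ) (F G : A), D^[k] (F + G) = D^[k] F + D^[k] G := fun k F G =>
    iterate_map_add D k F G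
  have hz : ∀ k : ℕ, D^[k] (0 : A) = 0 := fun k => iterate_map_zero D k
  intro m n
  induction h : m + n generalizing m n with
  | zero =>
    intro F G hF hG
    obtain ⟨rfl, rfl⟩ : m = 0 ∧ n = 0 := by omega
    simp only [zero_add, Function.iterate_one] at hF hG ⊢
    simp [hF, hG]
  | succ N ih =>
    intro F G hF hG
    rw [Function.iterate_succ_apply, D.leibniz, hadd, smul_eq_mul, smul_eq_mul]
    have h1 : D^[N + 1] (F * D G) = 0 := by
      rcases n with _ | n
      · rw [zero_add, Function.iterate_one] at hG
        rw [hG, mul_zero, hz]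
      · exact ih m n (by omega) F (D G) hF (by rwa [← Function.iterate_succ_apply])
    have h2 : D^[N + 1] (G * D F) = 0 := by
      rcases m with _ | m
      · rw [zero_add, Function.iterate_one] at hF
        rw [hF, mul_zero, hz]
      · exact ih n m (by omega) G (D F) hG (by rwa [← Function.iterate_succ_apply])
    rw [h1, h2, add_zero]

/-- The exponential series of `phiDer` ends on each polynomial: `D^k` kills a polynomial in the
`p_n` of degree less than `k`. -/
lemma phiDer_iterate_eq_zero (q : K) (f : SymF K) {k : ℕ} (hk : f.totalDegree < k) :
    (phiDer r q)^[k] (MvPolynomial.rename Sum.inl f) = 0 := by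
  set D : Derivation K (MvPolynomial (ℕ+ ⊕ Fin r) K) (MvPolynomial (ℕ+ ⊕ Fin r) K) :=
    phiDer r q with hD
  have hz : ∀ k : ℕ, D^[k] 0 = 0 := fun k => iterate_map_zero D k
  have hX : ∀ n : ℕ+, D^[1 + 1] (MvPolynomial.X (Sum.inl n)) = 0 := by
    intro n
    have hu : ∀ α : Fin r, D (MvPolynomial.X (Sum.inr α)) = 0 := by
      intro α; simp [hD, phiDer, MvPolynomial.mkDerivation_X]
    have h1 : D (MvPolynomial.X (Sum.inl n)) = MvPolynomial.C (q ^ (n : ℕ) - 1) *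
        ∑ α : Fin r, MvPolynomial.X (Sum.inr α) ^ (n : ℕ) := by
      simp [hD, phiDer, MvPolynomial.mkDerivation_X]
    rw [Function.iterate_succ_apply, Function.iterate_one, h1, D.leibniz, map_sum]
    simp [hu, Derivation.leibniz_pow, ← MvPolynomial.algebraMap_eq]
  have hmono : ∀ (s : ℕ+ →₀ ℕ) (c : K),
      D^[(s.sum fun _ e => e) + 1] (MvPolynomial.rename Sum.inl (MvPolynomial.monomial s c)) = 0 := by
    intro s
    induction s using Finsupp.induction_linear with
    | zero => intro c; simp [← MvPolynomial.C_apply, ← MvPolynomial.algebraMap_eq]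
    | add a b ha hb =>
      intro c
      have : (MvPolynomial.monomial (a + b) c : SymF K) =
          MvPolynomial.monomial a c * MvPolynomial.monomial b 1 := by
        rw [MvPolynomial.monomial_mul, mul_one]
      rw [this, map_mul, Finsupp.sum_add_index' (by simp) (by simp)]
      exact iterate_mul_eq_zero D _ _ _ _ (ha c) (hb 1)
    | single n e =>
      induction e with
      | zero => intro c; simp [← MvPolynomial.C_apply, ← MvPolynomial.algebraMap_eq]
      | succ e ih =>
        intro c
        have : (MvPolynomial.monomial (Finsupp.single n (e + 1)) c : SymF K) =
            MvPolynomial.monomial (Finsupp.single n e) c * MvPolynomial.X n := by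
          rw [MvPolynomial.X, MvPolynomial.monomial_mul, mul_one, Finsupp.single_add]
        rw [this, map_mul, MvPolynomial.rename_X]
        have h := iterate_mul_eq_zero D _ _ _ _ (ih c) (hX n)
        rw [Finsupp.sum_single_index rfl] at h ⊢
        exact h
  conv_lhs => rw [f.as_sum, map_sum]
  have hs : D^[k] (∑ s ∈ f.support,
      MvPolynomial.rename Sum.inl (MvPolynomial.monomial s (MvPolynomial.coeff s f))) =
      ∑ s ∈ f.support, D^[k]
        (MvPolynomial.rename Sum.inl (MvPolynomial.monomial s (MvPolynomial.coeff s f))) := by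
    induction f.support using Finset.induction_on with
    | empty => simp [hz]
    | insert a s ha ih => rw [Finset.sum_insert ha, Finset.sum_insert ha, iterate_map_add, ih]
  rw [hs]
  refine Finset.sum_eq_zero fun s hs => ?_
  have hle : (s.sum fun _ e => e) + 1 ≤ k := (MvPolynomial.le_totalDegree hs).trans_lt hk
  obtain ⟨j, rfl⟩ := Nat.exists_eq_add_of_le hle
  rw [add_comm, Function.iterate_add_apply, hmono, hz]

/-- `φ₋(z) f = exp (∑_{n ≥ 1} (q^n - 1) * ∑_α z_α^{-n} * ∂/∂p_n) f = ∑_k D^k f / k!`, where `D` is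
the differential operator in the exponent; `D^k f = 0` as soon as `k` exceeds the degree of `f`. -/
def phiMinus (r : ℕ) (q : K) (f : SymF K) : ZSeries K r :=
  MvPolynomial.aeval (Sum.elim (fun n => HahnSeries.C (MvPolynomial.X n)) (fun α => zpw α (-1)))
    (∑ k ∈ Finset.range (f.totalDegree + 1),
      (1 / (k.factorial : K)) • (phiDer r q)^[k] (MvPolynomial.rename Sum.inl f))

/-- The operator
`H^r = e_r(t^ρ) * ∮ ∏_α dz_α / (2πi z_α) Δ(z; t⁻¹) φ₊(z) φ₋(z)` on symmetric functions,
where `th` stands for `t^{1/2}`. -/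
def H [CharZero K] (q t th : K) (r : ℕ) (f : SymF K) : SymF K :=
  MvPolynomial.C (elem (pRho th) r) *
    constTerm (Delta r t⁻¹ * (phiPlus r t * phiMinus r q f))

end ZSeries

section Cauchy

variable {K : Type*} [Field K]

/-- `∑_{n ≥ 1} (1/n) * (1 - t^n) / (1 - q^n) * p_n(x) * p_n(y)`, a power series in the `p_n(y)`
whose coefficients are symmetric functions in `x`. -/
def cauchyExponent (q t : K) : MvPowerSeries ℕ+ (SymF K) := fun b =>
  ∑ n ∈ b.support, if b = Finsupp.single n 1 then
    MvPolynomial.C (1 / (n : K) * ((1 - t ^ (n : ℕ)) / (1 - q ^ (n : ℕ)))) * MvPolynomial.X n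
  else 0

lemma coeff_cauchyExponent (q t : K) (b : ℕ+ →₀ ℕ) :
    MvPowerSeries.coeff b (cauchyExponent q t) =
      ∑ n ∈ b.support, if b = Finsupp.single n 1 then
        MvPolynomial.C (1 / (n : K) * ((1 - t ^ (n : ℕ)) / (1 - q ^ (n : ℕ)))) * MvPolynomial.X n
      else 0 := rfl

lemma constantCoeff_cauchyExponent (q t : K) :
    MvPowerSeries.constantCoeff (cauchyExponent q t) = 0 := by
  rw [← MvPowerSeries.coeff_zero_eq_constantCoeff_apply, coeff_cauchyExponent, Finsupp.support_zero, Finset.sum_empty]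

variable [CharZero K]

/-- The Cauchy kernel `Π(x, y; q, t) = exp (∑ (1/n) (1 - t^n) / (1 - q^n) p_n(x) p_n(y))`. -/
def cauchyKernel (q t : K) : MvPowerSeries ℕ+ (SymF K) :=
  (PowerSeries.exp (SymF K)).subst (cauchyExponent q t)

lemma constantCoeff_cauchyKernel (q t : K) :
    MvPowerSeries.constantCoeff (cauchyKernel q t) = 1 := by
  rw [cauchyKernel, PowerSeries.constantCoeff_subst
    (PowerSeries.HasSubst.of_constantCoeff_zero (constantCoeff_cauchyExponent q t)),
    finsum_eq_single _ 0]
  · simp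
  · intro n hn
    rw [map_pow, constantCoeff_cauchyExponent, zero_pow hn, smul_zero]

/-- The reciprocal `1 / Π(x, y; q, t)`. -/
def cauchyKernelInv (q t : K) : MvPowerSeries ℕ+ (SymF K) :=
  MvPowerSeries.invOfUnit (cauchyKernel q t) 1

lemma cauchyKernel_mul_inv (q t : K) : cauchyKernel q t * cauchyKernelInv q t = 1 :=
  MvPowerSeries.mul_invOfUnit _ _ (by rw [constantCoeff_cauchyKernel, Units.val_one])

/-- The action of an operator on symmetric functions in `x` on a power series in the `p_n(y)`,
coefficient by coefficient. -/
def actX (T : SymF K → SymF K) (F : MvPowerSeries ℕ+ (SymF K)) : MvPowerSeries ℕ+ (SymF K) :=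
  fun b => T (MvPowerSeries.coeff b F)

/-- The specialization `p_n(x) ↦ p_n(t^{-ρ})`, where `th` stands for `t^{1/2}`. -/
def specX (th : K) : MvPowerSeries ℕ+ (SymF K) →+* MvPowerSeries ℕ+ K :=
  MvPowerSeries.map (MvPolynomial.eval (pNegRho th))

/-- The power sums `p_n(y, t^{-ρ}) = p_n(y) + p_n(t^{-ρ})`. -/
def pYNegRho (th : K) (n : ℕ+) : MvPowerSeries ℕ+ K :=
  MvPowerSeries.X n + MvPowerSeries.C (pNegRho th n)

end Cauchy

end Mac

end

noncomputable section

namespace Mac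

/-! `phiMinus` is the exponential of a constant-coefficient first-order operator, hence the
translation `p_n ↦ p_n + (q^n - 1) ∑ z_α^{-n}`. Applied to the Cauchy kernel it reproduces the
kernel times `∏ G(Y / z_α)`, where `G(Y / z) = exp (-∑ (1 - t^n)/n * p_n(y) z^{-n})`; the factor `1
- q^n` cancels (`map_cauchyKernel`). At `x = t^{-ρ}` the factor `phiPlus` collapses to `∏ (1 - z_α /
th)` and `Delta` is the product over `α < β` of `(1 - z_α/z_β) / (1 - s z_α/z_β)`, with `s = t⁻¹`.
Writing `1 - z/th = -th⁻¹ z (1 - th/z)`, the claim reduces to the constant term of `∏_j z_j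
Q_j(1/z_j)`, where `Q_j(u) = (1 - th u) G(Y u) ∏_{i<j} (1 - z_i u) / (1 - s z_i u)`.

The variables are eliminated from the last one down (`yConstTerm_prod`). Let `B(u) = ∑ (-u)^r e_r(y,
t^{-ρ})`. Comparing exponents gives `B(u) = (1 - th u) G(Y u) B(t u)` (`expSum_pYNegRho_eq`), a
functional equation that replaces any infinite product and so needs no convergence. Dressing `B` by
the factors `1 / (1 - s z_i u)`, `i < j`, gives a `B_j` with `B_j(u) = Q_j(u) B_j(t u)`, because `s
t = 1` (`dressed_eq`). Comparing coefficients in this equation shows that the constant term in `z_j`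
turns `z_j Q_j(1/z_j) [u^k] B_{j+1}` into `s^k (1 - t^{k+1}) [u^{k+1}] B_j`
(`sum_mul_pow_mul_coeff`, `map_mul_coeff_mul_geom`). Starting from `[u^0] B_r = 1`, after `r` steps
one reaches `∏_{i<r} s^i (1 - t^{i+1})` times `[u^r] B`.

The powers of `s` give `t^{-r(r-1)/2}`; the factors `1 - t^{i+1}` and the powers of `th` cancel
against `e_r(t^ρ)` (`coeff_expSum_pRho`). -/

/-! ### The exponential law for formal power series -/

open PowerSeries in
lemma exp_subst_X_add_X (A : Type*) [CommRing A] [Algebra ℚ A] :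
    (exp A).subst (MvPowerSeries.X 0 + MvPowerSeries.X 1 : MvPowerSeries (Fin 2) A) =
      (exp A).subst (MvPowerSeries.X 0 : MvPowerSeries (Fin 2) A) *
        (exp A).subst (MvPowerSeries.X 1 : MvPowerSeries (Fin 2) A) := by
  ext e
  rw [coeff_subst_X_zero_add_X_one, coeff_subst_X_zero_subst_mul_X_one]
  simp only [coeff_exp]
  rw [← map_natCast (algebraMap ℚ A), ← map_mul, ← map_mul]
  congr 1
  rw [Nat.cast_add_choose]
  have h := fun n : ℕ => Nat.cast_ne_zero (R := ℚ).mpr n.factorial_ne_zero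
  field_simp [h]

/-- Substitution of `F` and `G` into the universal two-variable identity `exp_subst_X_add_X`. -/
lemma exp_subst_add {τ A : Type*} [CommRing A] [Algebra ℚ A] {F G : MvPowerSeries τ A}
    (hF : MvPowerSeries.constantCoeff F = 0) (hG : MvPowerSeries.constantCoeff G = 0) :
    (PowerSeries.exp A).subst (F + G) =
      (PowerSeries.exp A).subst F * (PowerSeries.exp A).subst G := by
  have hb : MvPowerSeries.HasSubst ![F, G] :=
    MvPowerSeries.hasSubst_of_constantCoeff_zero (fun s => by fin_cases s <;> simp [hF, hG])
  have hX : ∀ X : MvPowerSeries (Fin 2) A, MvPowerSeries.constantCoeff X = 0 →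
      MvPowerSeries.subst ![F, G] ((PowerSeries.exp A).subst X) =
        (PowerSeries.exp A).subst (MvPowerSeries.subst ![F, G] X) := fun X hX =>
    MvPowerSeries.subst_comp_subst_apply
      (PowerSeries.HasSubst.of_constantCoeff_zero hX).const hb (PowerSeries.exp A)
  have h := congrArg (MvPowerSeries.subst (![F, G])) (exp_subst_X_add_X A)
  rw [MvPowerSeries.subst_mul hb, hX _ (by simp), hX _ (by simp), hX _ (by simp),
    MvPowerSeries.subst_add hb, MvPowerSeries.subst_X hb, MvPowerSeries.subst_X hb] at h
  simpa using h

/-! ### Exponentials of series in one variable -/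

section ExpSum

variable {A B : Type*} [CommRing A] [CommRing B]

lemma coeff_sumPos_succ (c : ℕ+ → A) (n : ℕ) :
    PowerSeries.coeff (n + 1) (sumPos c) = c n.succPNat := by
  simp [sumPos]; rfl

lemma sumPos_ext {F : PowerSeries A} {c : ℕ+ → A} (h0 : PowerSeries.constantCoeff F = 0)
    (h : ∀ n : ℕ+, PowerSeries.coeff n F = c n) : F = sumPos c := by
  ext n
  rcases n with _ | n
  · simp [h0, constantCoeff_sumPos]
  · rw [coeff_sumPos_succ, ← h]; rfl

lemma coeff_sumPos (c : ℕ+ → A) (n : ℕ+) : PowerSeries.coeff n (sumPos c) = c n := by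
  simp [sumPos]
  rfl

lemma sumPos_add (c d : ℕ+ → A) : sumPos (c + d) = sumPos c + sumPos d :=
  (sumPos_ext (by simp [constantCoeff_sumPos]) (by simp [coeff_sumPos])).symm

lemma map_sumPos (f : A →+* B) (c : ℕ+ → A) :
    PowerSeries.map f (sumPos c) = sumPos (fun n => f (c n)) :=
  sumPos_ext
    (by rw [← PowerSeries.coeff_zero_eq_constantCoeff_apply, PowerSeries.coeff_map]
        simp [constantCoeff_sumPos])
    (by simp [coeff_sumPos])

lemma hasSubst_sumPos (c : ℕ+ → A) : PowerSeries.HasSubst (sumPos c) :=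
  PowerSeries.HasSubst.of_constantCoeff_zero' (constantCoeff_sumPos c)

variable [Algebra ℚ A] [Algebra ℚ B]

/-- The power series `exp (∑_{n ≥ 1} c n * w ^ n)`. -/
def expSum (c : ℕ+ → A) : PowerSeries A := (PowerSeries.exp A).subst (sumPos c)

lemma expSum_add (c d : ℕ+ → A) : expSum (c + d) = expSum c * expSum d := by
  rw [expSum, sumPos_add]
  exact exp_subst_add (constantCoeff_sumPos c) (constantCoeff_sumPos d)

lemma constantCoeff_exp_subst {τ : Type*} {F : MvPowerSeries τ A}
    (hF : MvPowerSeries.constantCoeff F = 0) :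
    MvPowerSeries.constantCoeff ((PowerSeries.exp A).subst F) = 1 := by
  rw [PowerSeries.constantCoeff_subst (PowerSeries.HasSubst.of_constantCoeff_zero hF),
    finsum_eq_single _ 0]
  · simp
  · intro n hn
    rw [map_pow, hF, zero_pow hn, smul_zero]

lemma constantCoeff_expSum (c : ℕ+ → A) : PowerSeries.constantCoeff (expSum c) = 1 :=
  constantCoeff_exp_subst (constantCoeff_sumPos c)

lemma map_expSum (f : A →+* B) (c : ℕ+ → A) :
    PowerSeries.map f (expSum c) = expSum (fun n => f (c n)) := by
  rw [expSum, expSum, ← map_sumPos, ← PowerSeries.map_exp f]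
  exact PowerSeries.map_subst (hasSubst_sumPos c) (PowerSeries.exp A)

lemma derivative_expSum (c : ℕ+ → A) :
    PowerSeries.derivative A (expSum c) =
      PowerSeries.derivative A (sumPos c) * expSum c := by
  rw [expSum, PowerSeries.derivative_subst (hasSubst_sumPos c), PowerSeries.derivative_exp,
    mul_comm]

lemma rescale_expSum (a : A) (c : ℕ+ → A) :
    PowerSeries.rescale a (expSum c) = expSum (fun n => a ^ (n : ℕ) * c n) := by
  have h : PowerSeries.rescale a (sumPos c) = sumPos (fun n => a ^ (n : ℕ) * c n) :=
    sumPos_ext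
      (by rw [← PowerSeries.coeff_zero_eq_constantCoeff_apply, PowerSeries.coeff_rescale]
          simp [constantCoeff_sumPos])
      (by simp [coeff_sumPos])
  have hs : PowerSeries.HasSubst (a • PowerSeries.X : PowerSeries A) :=
    PowerSeries.HasSubst.smul_X' a
  rw [expSum, expSum, ← h, PowerSeries.rescale_eq_subst, PowerSeries.rescale_eq_subst,
    PowerSeries.subst_comp_subst_apply (hasSubst_sumPos c) hs]

/-- `exp (- ∑ (a w)^n / n) = 1 - a w`. -/
lemma expSum_neg_log (a : A) :
    expSum (fun n => -(algebraMap ℚ A (1 / (n : ℚ)) * a ^ (n : ℕ))) =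
      1 - PowerSeries.C a * PowerSeries.X := by
  set c : ℕ+ → A := fun n => -(algebraMap ℚ A (1 / (n : ℚ)) * a ^ (n : ℕ)) with hc
  -- The logarithmic derivative is that of `1 - a w`; the resulting linear differential equation
  -- determines all coefficients.
  have hS : PowerSeries.derivative A (sumPos c) * (1 - PowerSeries.C a * PowerSeries.X) =
      - PowerSeries.C a := by
    ext n
    have hd : ∀ n : ℕ, PowerSeries.coeff n (PowerSeries.derivative A (sumPos c)) =
        -a ^ (n + 1) := by
      intro n
      rw [PowerSeries.coeff_derivative, coeff_sumPos_succ, hc]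
      have : algebraMap ℚ A (1 / ((n.succPNat : ℕ) : ℚ)) * ((n : A) + 1) = 1 := by
        have h2 : ((n : A) + 1) = algebraMap ℚ A (n + 1) := by simp
        rw [h2, ← map_mul, Nat.succPNat_coe, Nat.cast_succ, one_div, inv_mul_cancel₀, map_one]
        positivity
      simp only [Nat.succPNat_coe, Nat.succ_eq_add_one] at this ⊢
      linear_combination (-a ^ (n + 1)) * this
    rcases n with _ | n
    · simp [mul_sub]
      simpa using hd 0
    · rw [mul_sub, mul_one, ← mul_assoc, map_sub, PowerSeries.coeff_succ_mul_X, hd,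
        PowerSeries.coeff_mul_C, hd, map_neg, PowerSeries.coeff_C]
      simp [pow_succ]
  have hf : PowerSeries.derivative A (expSum c) * (1 - PowerSeries.C a * PowerSeries.X) =
      -(PowerSeries.C a * expSum c) := by
    rw [derivative_expSum]
    linear_combination expSum c * hS
  -- The factor `n - 1` vanishes at `n = 1`, which kills the coefficient of degree 2 and then all
  -- later ones.
  have hrec : ∀ n : ℕ, PowerSeries.coeff (n + 1) (expSum c) * ((n : A) + 1) =
      ((n : A) - 1) * a * PowerSeries.coeff n (expSum c) := by
    intro n
    have h := congrArg (PowerSeries.coeff n) hf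
    rcases n with _ | n
    · rw [mul_sub, mul_one, ← mul_assoc, map_sub, PowerSeries.coeff_zero_mul_X,
        PowerSeries.coeff_derivative, map_neg, PowerSeries.coeff_C_mul] at h
      simp at h ⊢
      exact h
    · rw [mul_sub, mul_one, ← mul_assoc, map_sub, PowerSeries.coeff_succ_mul_X,
        PowerSeries.coeff_mul_C, PowerSeries.coeff_derivative, PowerSeries.coeff_derivative,
        map_neg, PowerSeries.coeff_C_mul] at h
      push_cast at h ⊢
      linear_combination h
  -- `A` need not be a domain: division by `n + 1` comes from the `ℚ`-algebra structure.
  have hcancel : ∀ (n : ℕ) (x y : A), x * ((n : A) + 1) = y →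
      x = algebraMap ℚ A (1 / ((n : ℚ) + 1)) * y := by
    intro n x y h
    have h2 : algebraMap ℚ A (1 / ((n : ℚ) + 1)) * ((n : A) + 1) = 1 := by
      have h2 : ((n : A) + 1) = algebraMap ℚ A (n + 1) := by simp
      rw [h2, ← map_mul, one_div, inv_mul_cancel₀, map_one]
      positivity
    rw [← h]
    linear_combination -x * h2
  have h0 : PowerSeries.coeff 0 (expSum c) = 1 := by
    rw [PowerSeries.coeff_zero_eq_constantCoeff_apply, constantCoeff_expSum]
  have h1 : PowerSeries.coeff 1 (expSum c) = -a := by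
    have := hrec 0
    simpa [h0, constantCoeff_expSum] using this
  have h2 : ∀ n : ℕ, PowerSeries.coeff (n + 2) (expSum c) = 0 := by
    intro n
    induction n with
    | zero =>
      rw [hcancel 1 _ _ (hrec 1)]
      simp
    | succ n ih =>
      rw [show n + 1 + 2 = (n + 2) + 1 from rfl, hcancel (n + 2) _ _ (hrec (n + 2)), ih]
      simp
  ext n
  rcases n with _ | _ | n
  · simpa using h0
  · rw [zero_add, h1, map_sub, PowerSeries.coeff_C_mul, PowerSeries.coeff_one_X]
    simp [PowerSeries.coeff_one]
  · rw [h2, map_sub, PowerSeries.coeff_C_mul, PowerSeries.coeff_X, PowerSeries.coeff_one]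
    simp

lemma elem_eq (p : ℕ+ → A) (r : ℕ) :
    elem p r = (-1) ^ r *
      PowerSeries.coeff r (expSum fun n => -(algebraMap ℚ A (1 / (n : ℚ)) * p n)) := rfl

end ExpSum

/-! ### Exponentials of linear forms in the power sums of `y`, and the weight grading -/

section Linear

variable {R S : Type*} [CommRing R] [CommRing S]

/-- The linear power series `∑ c n * Y n`. -/
def linSeries (c : ℕ+ → R) : MvPowerSeries ℕ+ R := fun b =>
  ∑ n ∈ b.support, if b = Finsupp.single n 1 then c n else 0

lemma coeff_linSeries (c : ℕ+ → R) (b : ℕ+ →₀ ℕ) :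
    MvPowerSeries.coeff b (linSeries c) =
      ∑ n ∈ b.support, if b = Finsupp.single n 1 then c n else 0 := rfl

lemma constantCoeff_linSeries (c : ℕ+ → R) : MvPowerSeries.constantCoeff (linSeries c) = 0 := by
  rw [← MvPowerSeries.coeff_zero_eq_constantCoeff_apply, coeff_linSeries, Finsupp.support_zero,
    Finset.sum_empty]

lemma linSeries_add (c d : ℕ+ → R) : linSeries (c + d) = linSeries c + linSeries d := by
  ext b
  simp only [map_add, coeff_linSeries, ← Finset.sum_add_distrib]
  refine Finset.sum_congr rfl fun n _ => ?_
  split_ifs <;> simp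

lemma linSeries_zero : linSeries (0 : ℕ+ → R) = 0 := by
  ext b
  simp [coeff_linSeries]

lemma map_linSeries (f : R →+* S) (c : ℕ+ → R) :
    MvPowerSeries.map f (linSeries c) = linSeries (fun n => f (c n)) := by
  ext b
  simp only [MvPowerSeries.coeff_map, coeff_linSeries, map_sum, apply_ite f, map_zero]

lemma rescale_linSeries (a c : ℕ+ → R) :
    MvPowerSeries.rescale a (linSeries c) = linSeries (a * c) := by
  ext b
  simp only [MvPowerSeries.coeff_rescale, coeff_linSeries, Finset.mul_sum]
  refine Finset.sum_congr rfl fun n _ => ?_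
  split_ifs with h
  · subst h; simp
  · simp

lemma hasSubst_linSeries (c : ℕ+ → R) : PowerSeries.HasSubst (linSeries c) :=
  PowerSeries.HasSubst.of_constantCoeff_zero (constantCoeff_linSeries c)

/-- The weight `∑ n * b n` of a multi-index. -/
def wt : (ℕ+ →₀ ℕ) →+ ℕ := Finsupp.liftAddHom fun n => AddMonoidHom.mulLeft (n : ℕ)

lemma wt_single (n : ℕ+) (k : ℕ) : wt (Finsupp.single n k) = n * k := by
  simp [wt]

lemma prod_pow_eq_pow_wt (u : R) (b : ℕ+ →₀ ℕ) :
    (b.prod fun n k => (u ^ (n : ℕ)) ^ k) = u ^ wt b := by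
  simp only [← pow_mul]
  rw [Finsupp.prod, Finset.prod_pow_eq_pow_sum]
  rfl

/-- The part of weight `l` of a power series. -/
def wtPart (l : ℕ) (F : MvPowerSeries ℕ+ R) : MvPowerSeries ℕ+ R := fun b =>
  if wt b = l then MvPowerSeries.coeff b F else 0

lemma coeff_wtPart (l : ℕ) (F : MvPowerSeries ℕ+ R) (b : ℕ+ →₀ ℕ) :
    MvPowerSeries.coeff b (wtPart l F) = if wt b = l then MvPowerSeries.coeff b F else 0 := rfl

/-- The ring homomorphism `F(Y₁, Y₂, …) ↦ F(u Y₁, u² Y₂, …)`, with `u` a new variable. -/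
def wtSeries : MvPowerSeries ℕ+ R →+* PowerSeries (MvPowerSeries ℕ+ R) where
  toFun F := PowerSeries.mk fun l => wtPart l F
  map_zero' := by
    ext l b
    rw [PowerSeries.coeff_mk, coeff_wtPart]
    simp
  map_add' F G := by
    ext l b
    rw [map_add, PowerSeries.coeff_mk, PowerSeries.coeff_mk, PowerSeries.coeff_mk, map_add,
      coeff_wtPart, coeff_wtPart, coeff_wtPart]
    split_ifs <;> simp
  map_one' := by
    classical
    ext l b
    rw [PowerSeries.coeff_mk, coeff_wtPart, PowerSeries.coeff_one]
    by_cases hb : b = 0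
    · subst hb
      by_cases hl : l = 0
      · simp [hl]
      · simp [hl, Ne.symm hl]
    · by_cases hl : l = 0 <;> simp [hl, hb, MvPowerSeries.coeff_one]
  map_mul' F G := by
    classical
    ext l b
    rw [PowerSeries.coeff_mk, coeff_wtPart, PowerSeries.coeff_mul, map_sum]
    simp only [PowerSeries.coeff_mk, MvPowerSeries.coeff_mul]
    rw [Finset.sum_comm]
    have : ∀ y ∈ Finset.HasAntidiagonal.antidiagonal b, ∑ x ∈ Finset.HasAntidiagonal.antidiagonal l,
        (MvPowerSeries.coeff y.1 (wtPart x.1 F) * MvPowerSeries.coeff y.2 (wtPart x.2 G)) =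
        if wt b = l then MvPowerSeries.coeff y.1 F * MvPowerSeries.coeff y.2 G else 0 := by
      intro y hy
      simp only [coeff_wtPart]
      have hw : wt b = wt y.1 + wt y.2 := by
        rw [← Finset.HasAntidiagonal.mem_antidiagonal.mp hy, map_add]
      rw [hw]
      by_cases h : wt y.1 + wt y.2 = l
      · rw [if_pos h, Finset.sum_eq_single (wt y.1, wt y.2)]
        · simp
        · intro x _ hx
          by_cases h1 : wt y.1 = x.1
          · by_cases h2 : wt y.2 = x.2
            · exact absurd (Prod.ext h1.symm h2.symm) hx
            · simp [h2]
          · simp [h1]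
        · intro hh
          exact absurd (Finset.HasAntidiagonal.mem_antidiagonal.mpr h) hh
      · rw [if_neg h]
        refine Finset.sum_eq_zero fun x hx => ?_
        rw [Finset.HasAntidiagonal.mem_antidiagonal] at hx
        by_cases h1 : wt y.1 = x.1
        · by_cases h2 : wt y.2 = x.2
          · exact absurd (by omega) h
          · simp [h2]
        · simp [h1]
    rw [Finset.sum_congr rfl this]
    split_ifs <;> simp

lemma coeff_coeff_wtSeries (F : MvPowerSeries ℕ+ R) (l : ℕ) (b : ℕ+ →₀ ℕ) :
    MvPowerSeries.coeff b (PowerSeries.coeff l (wtSeries F)) =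
      if wt b = l then MvPowerSeries.coeff b F else 0 := by
  have : PowerSeries.coeff l (wtSeries F) = wtPart l F :=
    PowerSeries.coeff_mk l fun l => wtPart l F
  rw [this, coeff_wtPart]

lemma coeff_linSeries_eq (c : ℕ+ → R) (b : ℕ+ →₀ ℕ) (n : ℕ+) (h : wt b = n) :
    MvPowerSeries.coeff b (linSeries c) = MvPowerSeries.coeff b (MvPowerSeries.C (c n) *
      MvPowerSeries.X n) := by
  classical
  rw [MvPowerSeries.coeff_C_mul, MvPowerSeries.coeff_X, coeff_linSeries]
  by_cases hb : b = Finsupp.single n 1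
  · subst hb
    rw [Finsupp.support_single _ (one_ne_zero (α := ℕ))]
    simp
  · rw [if_neg hb, mul_zero]
    refine Finset.sum_eq_zero fun m _ => ?_
    rw [if_neg]
    rintro rfl
    rw [wt_single, mul_one] at h
    exact hb (by rw [PNat.coe_injective h])

lemma wtSeries_linSeries (c : ℕ+ → R) :
    wtSeries (linSeries c) = sumPos fun n => MvPowerSeries.C (c n) * MvPowerSeries.X n := by
  classical
  apply sumPos_ext
  · ext b
    rw [← PowerSeries.coeff_zero_eq_constantCoeff_apply, coeff_coeff_wtSeries, coeff_linSeries]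
    split_ifs with h
    · rw [map_zero]
      refine Finset.sum_eq_zero fun m _ => ?_
      rw [if_neg]
      rintro rfl
      simp [wt_single] at h
    · simp
  · intro n
    ext b
    rw [coeff_coeff_wtSeries]
    split_ifs with h
    · exact coeff_linSeries_eq c b n h
    · rw [MvPowerSeries.coeff_C_mul, MvPowerSeries.coeff_X, if_neg, mul_zero]
      rintro rfl
      simp [wt_single] at h

variable [Algebra ℚ R] [Algebra ℚ S]

/-- The power series `exp (∑ c n * Y n)`. -/
def expLin (c : ℕ+ → R) : MvPowerSeries ℕ+ R := (PowerSeries.exp R).subst (linSeries c)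

lemma expLin_add (c d : ℕ+ → R) : expLin (c + d) = expLin c * expLin d := by
  rw [expLin, linSeries_add]
  exact exp_subst_add (constantCoeff_linSeries c) (constantCoeff_linSeries d)

lemma map_expLin (f : R →+* S) (c : ℕ+ → R) :
    MvPowerSeries.map f (expLin c) = expLin (fun n => f (c n)) := by
  rw [expLin, expLin, ← map_linSeries, ← PowerSeries.map_exp f]
  exact PowerSeries.map_subst (hasSubst_linSeries c) (PowerSeries.exp R)

lemma rescale_expLin (a c : ℕ+ → R) :
    MvPowerSeries.rescale a (expLin c) = expLin (a * c) := by
  ext b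
  rw [MvPowerSeries.coeff_rescale, expLin, expLin, ← rescale_linSeries,
    PowerSeries.coeff_subst (hasSubst_linSeries c), PowerSeries.coeff_subst
      (by rw [rescale_linSeries]; exact hasSubst_linSeries _),
    mul_finsum' _ _ (PowerSeries.coeff_subst_finite (hasSubst_linSeries c) _ _)]
  refine finsum_congr fun d => ?_
  rw [← map_pow, MvPowerSeries.coeff_rescale, mul_smul_comm]

lemma expLin_zero : expLin (0 : ℕ+ → R) = 1 := by
  rw [expLin, linSeries_zero, PowerSeries.subst_zero_eq_C_constantCoeff]
  simp

lemma expLin_sum {ι : Type*} (s : Finset ι) (c : ι → ℕ+ → R) :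
    expLin (∑ i ∈ s, c i) = ∏ i ∈ s, expLin (c i) := by
  classical
  induction s using Finset.induction_on with
  | empty => simp [expLin_zero]
  | insert a s ha ih => rw [Finset.sum_insert ha, Finset.prod_insert ha, expLin_add, ih]

/-- A ring homomorphism need not commute with infinite sums, so the exponential is compared
coefficient by coefficient, where only finitely many powers contribute. -/
lemma wtSeries_expLin (c : ℕ+ → R) :
    wtSeries (expLin c) = expSum fun n => MvPowerSeries.C (c n) * MvPowerSeries.X n := by
  ext l b
  rw [coeff_coeff_wtSeries, expSum, ← wtSeries_linSeries, PowerSeries.coeff_subst'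
    (by rw [wtSeries_linSeries]; exact hasSubst_sumPos _)]
  have hf : (Function.support fun d => PowerSeries.coeff d (PowerSeries.exp (MvPowerSeries ℕ+ R)) •
      PowerSeries.coeff l (wtSeries (linSeries c) ^ d)).Finite :=
    PowerSeries.coeff_subst_finite' (by rw [wtSeries_linSeries]; exact hasSubst_sumPos _) _ _
  have hm := AddMonoidHom.map_finsum (MvPowerSeries.coeff (R := R) b).toAddMonoidHom hf
  rw [LinearMap.toAddMonoidHom_coe] at hm
  rw [hm]
  have : ∀ d, MvPowerSeries.coeff (R := R) b
      (PowerSeries.coeff d (PowerSeries.exp (MvPowerSeries ℕ+ R)) •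
        PowerSeries.coeff l (wtSeries (linSeries c) ^ d)) =
      if wt b = l then PowerSeries.coeff d (PowerSeries.exp R) •
        MvPowerSeries.coeff b (linSeries c ^ d) else 0 := by
    intro d
    have h1 : PowerSeries.coeff d (PowerSeries.exp (MvPowerSeries ℕ+ R)) =
        MvPowerSeries.C (PowerSeries.coeff d (PowerSeries.exp R)) := by
      rw [PowerSeries.coeff_exp, PowerSeries.coeff_exp]
      exact (RingHom.congr_fun (Subsingleton.elim (algebraMap ℚ (MvPowerSeries ℕ+ R))
        (MvPowerSeries.C.comp (algebraMap ℚ R))) _)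
    rw [smul_eq_mul, h1, MvPowerSeries.coeff_C_mul, ← map_pow,
      coeff_coeff_wtSeries, smul_eq_mul, mul_ite, mul_zero]
  rw [finsum_congr this]
  split_ifs
  · rw [expLin, PowerSeries.coeff_subst (hasSubst_linSeries c)]
  · simp

end Linear

/-! ### Evaluation of power series and exponentials in Hahn series -/

section Hahn

variable {Γ : Type*} [AddCommMonoid Γ] [LinearOrder Γ] [IsOrderedCancelAddMonoid Γ]
variable {R S : Type*} [CommRing R] [CommRing S]

open HahnSeries

lemma coeff_heval_of_pos {x : HahnSeries Γ R} (hx : 0 < x.orderTop) (f : PowerSeries R) (g : Γ) :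
    (PowerSeries.heval x f).coeff g = ∑ᶠ n : ℕ, PowerSeries.coeff n f * (x ^ n).coeff g := by
  rw [PowerSeries.coeff_heval]
  refine finsum_congr fun n => ?_
  rw [SummableFamily.coeff_apply, SummableFamily.powerSeriesFamily_of_orderTop_pos hx]
  simp

lemma finite_coeff_pow {x : HahnSeries Γ R} (hx : 0 < x.orderTop) (g : Γ) :
    {n : ℕ | (x ^ n).coeff g ≠ 0}.Finite := by
  have := (SummableFamily.powers x).finite_co_support g
  simpa [SummableFamily.powers_of_orderTop_pos hx] using! this

/-- Makes each coefficient of an evaluated power series a finite sum, with a cutoff independent of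
the power series. -/
lemma exists_coeff_pow_eq_zero {x : HahnSeries Γ R} (hx : 0 < x.orderTop) (g : Γ) :
    ∃ N : ℕ, ∀ n ≥ N, (x ^ n).coeff g = 0 := by
  obtain ⟨N, hN⟩ := (finite_coeff_pow hx g).bddAbove
  refine ⟨N + 1, fun n hn => ?_⟩
  by_contra h
  have : n ≤ N := hN h
  omega

lemma coeff_heval_eq_sum {x : HahnSeries Γ R} (hx : 0 < x.orderTop) (f : PowerSeries R) {g : Γ}
    {N : ℕ} (hN : ∀ n ≥ N, (x ^ n).coeff g = 0) :
    (PowerSeries.heval x f).coeff g =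
      ∑ n ∈ Finset.range N, PowerSeries.coeff n f * (x ^ n).coeff g := by
  rw [coeff_heval_of_pos hx]
  refine finsum_eq_sum_of_support_subset _ fun n hn => ?_
  rw [Function.mem_support] at hn
  rw [Finset.coe_range, Set.mem_Iio]
  by_contra h
  exact hn (by rw [hN n (not_lt.mp h), mul_zero])

lemma orderTop_heval_pos {x : HahnSeries Γ R} (hx : 0 < x.orderTop) {a : PowerSeries R}
    (ha : PowerSeries.constantCoeff a = 0) : 0 < (PowerSeries.heval x a).orderTop := by
  have hz : ∀ g ≤ (0 : Γ), (PowerSeries.heval x a).coeff g = 0 := by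
    intro g hg
    rw [coeff_heval_of_pos hx]
    refine finsum_eq_zero_of_forall_eq_zero fun n => ?_
    rcases n with _ | n
    · simp [ha]
    · rw [coeff_eq_zero_of_lt_orderTop, mul_zero]
      refine lt_of_le_of_lt ?_ (((nsmul_pos_iff n.succ_ne_zero).mpr hx).trans_le
        orderTop_nsmul_le_orderTop_pow)
      exact_mod_cast hg
  by_cases h0 : PowerSeries.heval x a = 0
  · rw [h0]; simp
  · by_contra h
    rw [not_lt] at h
    have hne : (PowerSeries.heval x a).orderTop ≠ ⊤ := orderTop_ne_top.mpr h0
    obtain ⟨g, hg⟩ := WithTop.ne_top_iff_exists.mp hne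
    refine coeff_orderTop_ne hg.symm (hz g ?_)
    rw [← hg] at h
    exact_mod_cast h

/-- Evaluation of power series at `heval x a` is evaluation of the composite at `x`. -/
lemma heval_heval [Algebra ℚ R] {x : HahnSeries Γ R} (hx : 0 < x.orderTop) {a : PowerSeries R}
    (ha : PowerSeries.constantCoeff a = 0) (f : PowerSeries R) :
    PowerSeries.heval (PowerSeries.heval x a) f = PowerSeries.heval x (f.subst a) := by
  ext g
  obtain ⟨N, hN⟩ := exists_coeff_pow_eq_zero hx g
  have hs : PowerSeries.HasSubst a := PowerSeries.HasSubst.of_constantCoeff_zero' ha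
  -- Since `a` has no constant term, one cutoff `N` serves both the inner and the outer sum, and the
  -- two can be interchanged.
  have hlow : ∀ k n : ℕ, n < k → PowerSeries.coeff n (a ^ k) = 0 := by
    intro k n hnk
    exact PowerSeries.coeff_of_lt_order _ (lt_of_lt_of_le (by exact_mod_cast hnk)
      (PowerSeries.le_order_pow_of_constantCoeff_eq_zero k ha))
  have hN' : ∀ n ≥ N, ((PowerSeries.heval x a) ^ n).coeff g = 0 := by
    intro n hn
    rw [← map_pow, coeff_heval_eq_sum hx _ hN]
    refine Finset.sum_eq_zero fun k hk => ?_
    rw [hlow n k (by rw [Finset.mem_range] at hk; omega), zero_mul]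
  rw [coeff_heval_eq_sum (orderTop_heval_pos hx ha) f hN', coeff_heval_eq_sum hx _ hN]
  have h1 : ∀ n ∈ Finset.range N, PowerSeries.coeff n (f.subst a) =
      ∑ k ∈ Finset.range N, PowerSeries.coeff k f * PowerSeries.coeff n (a ^ k) := by
    intro n hn
    rw [PowerSeries.coeff_subst' hs]
    simp only [smul_eq_mul]
    refine finsum_eq_sum_of_support_subset _ fun k hk => ?_
    rw [Function.mem_support] at hk
    rw [Finset.coe_range, Set.mem_Iio]
    by_contra h
    refine hk ?_
    rw [hlow k n (by rw [Finset.mem_range] at hn; omega), mul_zero]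
  rw [Finset.sum_congr rfl fun n hn => congrArg (· * (x ^ n).coeff g) (h1 n hn)]
  simp only [Finset.sum_mul]
  rw [Finset.sum_comm]
  refine Finset.sum_congr rfl fun k _ => ?_
  rw [← map_pow, coeff_heval_eq_sum hx _ hN, Finset.mul_sum]
  simp only [mul_assoc]

/-- Change of coefficients along a ring homomorphism. -/
def hmap (f : R →+* S) : HahnSeries Γ R →+* HahnSeries Γ S where
  toFun x := x.map (f : R →ₙ+* S)
  map_zero' := by ext; simp
  map_one' := by
    ext g
    rw [map_coeff, coeff_one, coeff_one]
    split_ifs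
    exacts [map_one f, map_zero f]
  map_add' x y := by ext; simp
  map_mul' _ _ := HahnSeries.map_mul (f : R →ₙ+* S)

lemma coeff_hmap (f : R →+* S) (x : HahnSeries Γ R) (g : Γ) :
    (hmap f x).coeff g = f (x.coeff g) := rfl

lemma orderTop_hmap_pos (f : R →+* S) {x : HahnSeries Γ R} (hx : 0 < x.orderTop) :
    0 < (hmap f x).orderTop := by
  by_cases h0 : hmap f x = 0
  · rw [h0]; simp
  · obtain ⟨g, hg⟩ := WithTop.ne_top_iff_exists.mp (orderTop_ne_top.mpr h0)
    rw [← hg]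
    by_contra h
    refine coeff_orderTop_ne hg.symm ?_
    rw [coeff_hmap, coeff_eq_zero_of_lt_orderTop ((not_lt.mp h).trans_lt hx), map_zero]

lemma hmap_single (f : R →+* S) (g : Γ) (a : R) :
    hmap f (HahnSeries.single g a) = HahnSeries.single g (f a) := by
  classical
  ext b
  rw [coeff_hmap, coeff_single, coeff_single, apply_ite f, map_zero]

lemma hmap_heval (f : R →+* S) {x : HahnSeries Γ R} (hx : 0 < x.orderTop) (p : PowerSeries R) :
    hmap f (PowerSeries.heval x p) = PowerSeries.heval (hmap f x) (PowerSeries.map f p) := by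
  ext g
  obtain ⟨N, hN⟩ := exists_coeff_pow_eq_zero hx g
  rw [coeff_hmap, coeff_heval_eq_sum hx p hN, coeff_heval_eq_sum (orderTop_hmap_pos f hx) _
    (fun n hn => by rw [← map_pow, coeff_hmap, hN n hn, map_zero]), map_sum]
  refine Finset.sum_congr rfl fun n _ => ?_
  rw [map_mul, ← map_pow, coeff_hmap, PowerSeries.coeff_map]

omit [IsOrderedCancelAddMonoid Γ] in
lemma orderTop_add_pos {x y : HahnSeries Γ R} (hx : 0 < x.orderTop) (hy : 0 < y.orderTop) :
    0 < (x + y).orderTop :=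
  (lt_min hx hy).trans_le min_orderTop_le_orderTop_add

omit [IsOrderedCancelAddMonoid Γ] in
lemma orderTop_sum_pos {ι : Type*} (s : Finset ι) (x : ι → HahnSeries Γ R)
    (hx : ∀ i ∈ s, 0 < (x i).orderTop) : 0 < (∑ i ∈ s, x i).orderTop := by
  classical
  induction s using Finset.induction_on with
  | empty => simp
  | insert a s ha ih =>
    rw [Finset.sum_insert ha]
    exact orderTop_add_pos (hx a (Finset.mem_insert_self a s))
      (ih fun i hi => hx i (Finset.mem_insert_of_mem hi))

variable [Algebra ℚ R]

/-- The exponential of a Hahn series of positive order. -/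
def hexp (x : HahnSeries Γ R) : HahnSeries Γ R := PowerSeries.heval x (PowerSeries.exp R)

lemma hexp_heval_sumPos {x : HahnSeries Γ R} (hx : 0 < x.orderTop) (c : ℕ+ → R) :
    hexp (PowerSeries.heval x (sumPos c)) = PowerSeries.heval x (expSum c) :=
  heval_heval hx (constantCoeff_sumPos c) _

lemma hexp_zero : hexp (0 : HahnSeries Γ R) = 1 := by
  have h := SummableFamily.powerSeriesFamily_hsum_zero (Γ := Γ) (V := R) (PowerSeries.exp R)
  rw [hexp, PowerSeries.heval_apply, h]
  simp

/-- The product is the sum of a summable family indexed by pairs; at a fixed exponent it is a finite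
sum, which regroups along antidiagonals into the binomial theorem. -/
lemma hexp_add {x y : HahnSeries Γ R} (hx : 0 < x.orderTop) (hy : 0 < y.orderTop) :
    hexp (x + y) = hexp x * hexp y := by
  have hxy := orderTop_add_pos hx hy
  ext g
  set e : ℕ → R := fun n => PowerSeries.coeff n (PowerSeries.exp R) with he
  set s := (SummableFamily.powerSeriesFamily x (PowerSeries.exp R)).mul
    (SummableFamily.powerSeriesFamily y (PowerSeries.exp R)) with hs
  have hsf : ∀ p : ℕ × ℕ, (s p).coeff g = e p.1 * e p.2 * (x ^ p.1 * y ^ p.2).coeff g := by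
    intro p
    rw [hs, SummableFamily.mul_toFun, SummableFamily.powerSeriesFamily_of_orderTop_pos hx,
      SummableFamily.powerSeriesFamily_of_orderTop_pos hy, Algebra.smul_mul_assoc,
      Algebra.mul_smul_comm, HahnSeries.coeff_smul, HahnSeries.coeff_smul, smul_eq_mul,
      smul_eq_mul, ← mul_assoc]
  have hfin : {p : ℕ × ℕ | (s p).coeff g ≠ 0}.Finite := s.finite_co_support g
  obtain ⟨N₁, hN₁⟩ := exists_coeff_pow_eq_zero hxy g
  obtain ⟨N₂, hN₂⟩ := (hfin.image fun p => p.1 + p.2).bddAbove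
  -- Large enough to exhaust both the powers of `x + y` and the pairs that contribute at `g`.
  set N := max N₁ (N₂ + 1) with hN
  have hprod : (hexp x * hexp y).coeff g = s.hsum.coeff g := by
    rw [hs, SummableFamily.hsum_mul]; rfl
  rw [hprod, hexp, coeff_heval_eq_sum hxy _ (N := N)
    (fun n hn => hN₁ n ((le_max_left _ _).trans hn))]
  have hsub : {p : ℕ × ℕ | (s p).coeff g ≠ 0} ⊆
      ((Finset.range N).sigma fun n => Finset.HasAntidiagonal.antidiagonal n).image
        fun q => q.2 := by
    intro p hp
    have h1 : p.1 + p.2 ≤ N₂ := hN₂ (Set.mem_image_of_mem _ hp)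
    rw [Finset.coe_image]
    refine ⟨⟨p.1 + p.2, p⟩, ?_, rfl⟩
    simp only [Finset.coe_sigma, Set.mem_sigma_iff, Finset.mem_coe, Finset.mem_range,
      Finset.HasAntidiagonal.mem_antidiagonal, and_true]
    exact (Nat.lt_succ_of_le h1).trans_le (le_max_right _ _)
  rw [SummableFamily.coeff_hsum_eq_sum_of_subset hsub, Finset.sum_image, Finset.sum_sigma]
  · refine Finset.sum_congr rfl fun n _ => ?_
    have hc : ∀ z : Finset (ℕ × ℕ), ∀ F : ℕ × ℕ → HahnSeries Γ R,
        (∑ p ∈ z, F p).coeff g = ∑ p ∈ z, (F p).coeff g := fun z F =>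
      map_sum (HahnSeries.coeff.addMonoidHom g) F z
    rw [(Commute.all x y).add_pow', hc, Finset.mul_sum]
    refine Finset.sum_congr rfl fun p hp => ?_
    rw [hsf, HahnSeries.coeff_nsmul]
    obtain rfl := Finset.HasAntidiagonal.mem_antidiagonal.mp hp
    simp only [Pi.smul_apply, nsmul_eq_mul, ← mul_assoc]
    congr 1
    simp only [he, PowerSeries.coeff_exp]
    rw [← map_natCast (algebraMap ℚ R), ← map_mul, ← map_mul, Nat.cast_add_choose]
    congr 1
    have h := fun n : ℕ => Nat.cast_ne_zero (R := ℚ).mpr n.factorial_ne_zero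
    field_simp [h]
  · rintro ⟨n, p⟩ hp ⟨m, q⟩ hq h
    simp only [Finset.coe_sigma, Set.mem_sigma_iff, Finset.mem_coe, Finset.mem_range,
      Finset.HasAntidiagonal.mem_antidiagonal] at hp hq h
    obtain rfl := h
    obtain rfl : n = m := hp.2.symm.trans hq.2
    rfl

lemma hexp_sum {ι : Type*} (s : Finset ι) (x : ι → HahnSeries Γ R)
    (hx : ∀ i ∈ s, 0 < (x i).orderTop) : hexp (∑ i ∈ s, x i) = ∏ i ∈ s, hexp (x i) := by
  classical
  induction s using Finset.induction_on with
  | empty => simp [hexp_zero]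
  | insert a s ha ih =>
    have h1 := hx a (Finset.mem_insert_self a s)
    have h2 : ∀ i ∈ s, 0 < (x i).orderTop := fun i hi => hx i (Finset.mem_insert_of_mem hi)
    rw [Finset.sum_insert ha, Finset.prod_insert ha, hexp_add h1 (orderTop_sum_pos s x h2), ih h2]

end Hahn

/-! ### Subrings cut out by conditions on supports and coefficients -/

section Support

variable {Γ : Type*} [AddCommMonoid Γ] [LinearOrder Γ] [IsOrderedCancelAddMonoid Γ]
variable {R : Type*} [CommRing R]

open HahnSeries

/-- The Hahn series supported on a given submonoid. -/
def suppIn (R : Type*) [CommRing R] (S : AddSubmonoid Γ) : Subring (HahnSeries Γ R) where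
  carrier := {x | x.support ⊆ S}
  mul_mem' := by
    intro x y hx hy g hg
    obtain ⟨a, ha, b, hb, rfl⟩ := support_mul_subset hg
    exact S.add_mem (hx ha) (hy hb)
  one_mem' := by
    intro g hg
    rw [mem_support, coeff_one] at hg
    obtain rfl : g = 0 := by
      by_contra h
      simp [h] at hg
    exact S.zero_mem
  add_mem' := by
    intro x y hx hy g hg
    rcases support_add_subset _ _ hg with h | h
    exacts [hx h, hy h]
  zero_mem' := by simp
  neg_mem' := by
    intro x hx
    rwa [Set.mem_ofPred_eq, support_neg]

lemma suppIn_mono {S T : AddSubmonoid Γ} (h : S ≤ T) : suppIn R S ≤ suppIn R T :=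
  fun _ hx => Set.Subset.trans hx h

lemma coeff_eq_zero_of_suppIn {S : AddSubmonoid Γ} {x : HahnSeries Γ R} (hx : x ∈ suppIn R S)
    {g : Γ} (hg : g ∉ S) : x.coeff g = 0 := by
  by_contra h
  exact hg (hx h)

lemma single_mem_suppIn {S : AddSubmonoid Γ} {g : Γ} (hg : g ∈ S) (a : R) :
    single g a ∈ suppIn R S :=
  support_single_subset.trans (Set.singleton_subset_iff.mpr hg)

lemma C_mem_suppIn (S : AddSubmonoid Γ) (a : R) : (C a : HahnSeries Γ R) ∈ suppIn R S :=
  single_mem_suppIn S.zero_mem a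

lemma heval_mem_suppIn {S : AddSubmonoid Γ} {x : HahnSeries Γ R} (hx : 0 < x.orderTop)
    (hS : x ∈ suppIn R S) (p : PowerSeries R) : PowerSeries.heval x p ∈ suppIn R S := by
  intro g hg
  by_contra h
  refine hg ?_
  rw [coeff_heval_of_pos hx]
  refine finsum_eq_zero_of_forall_eq_zero fun n => ?_
  rw [coeff_eq_zero_of_suppIn (Subring.pow_mem _ hS n) h, mul_zero]

/-- The power series with all coefficients in a given subring. -/
def coeffsIn {σ A : Type*} [CommRing A] (T : Subring A) :
    Subring (MvPowerSeries σ A) where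
  carrier := {F | ∀ b, MvPowerSeries.coeff b F ∈ T}
  mul_mem' := by
    classical
    intro F G hF hG b
    rw [MvPowerSeries.coeff_mul]
    exact T.sum_mem fun p _ => T.mul_mem (hF _) (hG _)
  one_mem' := by
    classical
    intro b
    rw [MvPowerSeries.coeff_one]
    split_ifs
    exacts [T.one_mem, T.zero_mem]
  add_mem' := by
    intro F G hF hG b
    rw [map_add]
    exact T.add_mem (hF b) (hG b)
  zero_mem' := by
    intro b
    rw [map_zero]
    exact T.zero_mem
  neg_mem' := by
    intro F hF b
    rw [map_neg]
    exact T.neg_mem (hF b)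

lemma coeffsIn_mono {σ A : Type*} [CommRing A] {T U : Subring A} (h : T ≤ U) :
    (coeffsIn T : Subring (MvPowerSeries σ A)) ≤ coeffsIn U :=
  fun _ hF b => h (hF b)

lemma C_mem_coeffsIn {σ A : Type*} [CommRing A] {T : Subring A} {a : A} (ha : a ∈ T) :
    (MvPowerSeries.C a : MvPowerSeries σ A) ∈ coeffsIn T := by
  classical
  intro b
  rw [MvPowerSeries.coeff_C]
  split_ifs
  exacts [ha, T.zero_mem]

end Support

/-! ### One elimination step, abstractly -/

section Recursion

variable {R : Type*} [CommRing R]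

/-- The geometric series `1 / (1 - a u)`. -/
def geom (a : R) : PowerSeries R := PowerSeries.mk fun n => a ^ n

lemma one_sub_mul_geom (a : R) : (1 - PowerSeries.C a * PowerSeries.X) * geom a = 1 := by
  ext n
  rw [sub_mul, one_mul, mul_assoc, map_sub, PowerSeries.coeff_C_mul]
  rcases n with _ | n
  · simp [geom]
  · rw [mul_comm PowerSeries.X, PowerSeries.coeff_succ_mul_X, PowerSeries.coeff_one, geom,
      PowerSeries.coeff_mk, PowerSeries.coeff_mk]
    simp [pow_succ']

lemma constantCoeff_geom (a : R) : PowerSeries.constantCoeff (geom a) = 1 := by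
  rw [← PowerSeries.coeff_zero_eq_constantCoeff_apply, geom, PowerSeries.coeff_mk, pow_zero]

lemma rescale_geom (t a : R) : PowerSeries.rescale t (geom a) = geom (t * a) := by
  ext n
  simp [geom, mul_pow]

/-- The coefficient of `u^{k+1}` in `B(u) = Q(u) B(t u)`: the constant term 1 of `Q` contributes
`t^{k+1}` times the top coefficient of `B`, moved to the right-hand side. On the rest, `s^j = s^k
t^i` for `i + j = k`. -/
lemma sum_mul_pow_mul_coeff {s t : R} (hst : s * t = 1) {B Q : PowerSeries R}
    (hQ : PowerSeries.constantCoeff Q = 1) (hB : B = Q * PowerSeries.rescale t B) (k : ℕ) :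
    ∑ p ∈ Finset.HasAntidiagonal.antidiagonal k, PowerSeries.coeff p.1 B * s ^ p.2 *
        PowerSeries.coeff (p.2 + 1) Q =
      s ^ k * (1 - t ^ (k + 1)) * PowerSeries.coeff (k + 1) B := by
  have h := congrArg (PowerSeries.coeff (k + 1)) hB
  rw [mul_comm Q, PowerSeries.coeff_mul, Finset.Nat.sum_antidiagonal_succ'] at h
  simp only [PowerSeries.coeff_rescale, PowerSeries.coeff_zero_eq_constantCoeff_apply, hQ,
    mul_one] at h
  have h2 : ∑ p ∈ Finset.HasAntidiagonal.antidiagonal k, PowerSeries.coeff p.1 B * s ^ p.2 *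
        PowerSeries.coeff (p.2 + 1) Q =
      s ^ k * ∑ p ∈ Finset.HasAntidiagonal.antidiagonal k,
        t ^ p.1 * PowerSeries.coeff p.1 B * PowerSeries.coeff (p.2 + 1) Q := by
    rw [Finset.mul_sum]
    refine Finset.sum_congr rfl fun p hp => ?_
    obtain rfl := Finset.HasAntidiagonal.mem_antidiagonal.mp hp
    have h3 : s ^ p.1 * t ^ p.1 = 1 := by rw [← mul_pow, hst, one_pow]
    rw [pow_add]
    linear_combination (-PowerSeries.coeff p.1 B * s ^ p.2 * PowerSeries.coeff (p.2 + 1) Q) * h3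
  rw [h2]
  linear_combination (-s ^ k) * h

/-- Here `L` is the constant term, `T` the ring of series free of `z`, and `X` plays `Q(1/z)`.
Expanding the geometric series pairs `s^j z^j` with the extra `z`, so `L` reads off the coefficient
`j + 1` of `Q`. -/
lemma map_mul_coeff_mul_geom {M : Type*} [AddCommMonoid M] (L : R →+ M) (T : Subring R)
    {z X s t : R} {Q B : PowerSeries R}
    (h : ∀ f ∈ T, ∀ l : ℕ, L (f * z ^ l * X) = L (f * PowerSeries.coeff l Q))
    (hst : s * t = 1) (hs : s ∈ T) (hQ : PowerSeries.constantCoeff Q = 1)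
    (hBT : ∀ n, PowerSeries.coeff n B ∈ T) (hB : B = Q * PowerSeries.rescale t B)
    {Y : R} (hY : Y ∈ T) (k : ℕ) :
    L (Y * (z * X) * PowerSeries.coeff k (B * geom (s * z))) =
      L (s ^ k * (1 - t ^ (k + 1)) * (Y * PowerSeries.coeff (k + 1) B)) := by
  rw [mul_left_comm _ Y, ← sum_mul_pow_mul_coeff hst hQ hB, PowerSeries.coeff_mul,
    Finset.mul_sum, Finset.mul_sum, map_sum, map_sum]
  refine Finset.sum_congr rfl fun p _ => ?_
  have h1 := h (Y * (PowerSeries.coeff p.1 B * s ^ p.2)) (T.mul_mem hY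
    (T.mul_mem (hBT _) (T.pow_mem hs _))) (p.2 + 1)
  rw [mul_assoc Y _ (PowerSeries.coeff (p.2 + 1) Q)] at h1
  rw [← h1, geom, PowerSeries.coeff_mk, mul_pow, pow_succ]
  congr 1
  ring

end Recursion

/-! ### Constant terms in one variable `z_μ` -/

section Elimination

variable {K : Type*} [Field K] {r : ℕ}

/-- Power series in the `p_n(y)` with coefficients Laurent series in the `z_α`. -/
abbrev YZ (K : Type*) [Field K] (r : ℕ) :=
  MvPowerSeries ℕ+ (HahnSeries (Lex (Fin r → ℤ)) K)

/-- Power series in the `p_n(y)` as constants in the `z_α`. -/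
def yConst (K : Type*) [Field K] (r : ℕ) : MvPowerSeries ℕ+ K →+* YZ K r :=
  MvPowerSeries.map HahnSeries.C

/-- The constant term in the `z_α`, coefficientwise in the `p_n(y)`. -/
def yConstTerm (K : Type*) [Field K] (r : ℕ) : YZ K r →+ MvPowerSeries ℕ+ K where
  toFun F := fun b => (MvPowerSeries.coeff b F).coeff 0
  map_zero' := by
    ext b
    rfl
  map_add' F G := by
    ext b
    rfl

lemma coeff_yConstTerm (F : YZ K r) (b : ℕ+ →₀ ℕ) :
    MvPowerSeries.coeff b (yConstTerm K r F) = (MvPowerSeries.coeff b F).coeff 0 := rfl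

lemma yConstTerm_mul (a : MvPowerSeries ℕ+ K) (F : YZ K r) :
    yConstTerm K r (yConst K r a * F) = a * yConstTerm K r F := by
  classical
  ext b
  rw [coeff_yConstTerm, MvPowerSeries.coeff_mul, MvPowerSeries.coeff_mul]
  refine (map_sum (HahnSeries.coeff.addMonoidHom (0 : Lex (Fin r → ℤ))) _ _).trans ?_
  refine Finset.sum_congr rfl fun p _ => ?_
  rw [yConst, MvPowerSeries.coeff_map, coeff_yConstTerm]
  exact HahnSeries.coeff_single_zero_mul

lemma yConstTerm_yConst (a : MvPowerSeries ℕ+ K) : yConstTerm K r (yConst K r a) = a := by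
  ext b
  rw [coeff_yConstTerm, yConst, MvPowerSeries.coeff_map]
  simp

/-- `z_α ^ k` as a Laurent series over `K`. -/
def zK (K : Type*) [Field K] {r : ℕ} (α : Fin r) (k : ℤ) : HahnSeries (Lex (Fin r → ℤ)) K :=
  HahnSeries.single (toLex (Pi.single α k)) 1

lemma zK_mul (α : Fin r) (k l : ℤ) : zK K α k * zK K α l = zK K α (k + l) := by
  rw [zK, zK, zK, HahnSeries.single_mul_single, one_mul, ← toLex_add, Pi.single_add]

lemma zK_zero (α : Fin r) : zK K α 0 = 1 := by
  rw [zK, Pi.single_zero]; rfl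

lemma zK_pow (α : Fin r) (k : ℤ) (n : ℕ) : zK K α k ^ n = zK K α (n * k) := by
  induction n with
  | zero => simp [zK_zero]
  | succ n ih => rw [pow_succ, ih, zK_mul]; push_cast; ring_nf

/-- `z_α ^ k` as a constant in the `p_n(y)`. -/
def zY (K : Type*) [Field K] {r : ℕ} (α : Fin r) (k : ℤ) : YZ K r := MvPowerSeries.C (zK K α k)

lemma zY_one_mul_zY_neg_one (α : Fin r) : zY K α 1 * zY K α (-1) = 1 := by
  rw [zY, zY, ← map_mul, zK_mul, add_neg_cancel, zK_zero, map_one]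

/-- Exponents of the monomials in the first `m` of the variables `z_α`. -/
def expLT (r m : ℕ) : AddSubmonoid (Lex (Fin r → ℤ)) where
  carrier := {a | ∀ j : Fin r, m ≤ j → ofLex a j = 0}
  add_mem' := by
    intro a b ha hb j hj
    rw [ofLex_add, Pi.add_apply, ha j hj, hb j hj, add_zero]
  zero_mem' := fun _ _ => rfl

/-- Exponents of the monomials in the `z_α`, `α ≤ μ`, with `z_μ` to a nonpositive power. -/
def expNonpos {r : ℕ} (μ : Fin r) : AddSubmonoid (Lex (Fin r → ℤ)) where
  carrier := {a | ofLex a μ ≤ 0 ∧ ∀ j : Fin r, μ < j → ofLex a j = 0}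
  add_mem' := by
    intro a b ha hb
    refine ⟨?_, fun j hj => ?_⟩
    · rw [ofLex_add, Pi.add_apply]
      exact add_nonpos ha.1 hb.1
    · rw [ofLex_add, Pi.add_apply, ha.2 j hj, hb.2 j hj, add_zero]
  zero_mem' := ⟨le_rfl, fun _ _ => rfl⟩

lemma expLT_le_expNonpos (μ : Fin r) : expLT r μ ≤ expNonpos μ :=
  fun _ ha => ⟨(ha μ le_rfl).le, fun j hj => ha j hj.le⟩

lemma expNonpos_le_expLT (μ : Fin r) : expNonpos μ ≤ expLT r (μ + 1) :=
  fun _ ha j hj => ha.2 j (Fin.lt_def.mpr hj)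

lemma expLT_mono {m n : ℕ} (h : m ≤ n) : expLT r m ≤ expLT r n :=
  fun _ ha j hj => ha j (h.trans hj)

variable (K) in
/-- Series in `z_α`, `α < m`. -/
def serLT (r m : ℕ) : Subring (YZ K r) := coeffsIn (suppIn K (expLT r m))

variable (K) in
/-- Series in `z_α`, `α ≤ μ`, with `z_μ` to nonpositive powers only. -/
def serNonpos (μ : Fin r) : Subring (YZ K r) := coeffsIn (suppIn K (expNonpos μ))

lemma serLT_le_serNonpos (μ : Fin r) : serLT K r μ ≤ serNonpos K μ :=
  coeffsIn_mono (suppIn_mono (expLT_le_expNonpos μ))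

lemma serNonpos_le_serLT (μ : Fin r) : serNonpos K μ ≤ serLT K r (μ + 1) :=
  coeffsIn_mono (suppIn_mono (expNonpos_le_expLT μ))

lemma serLT_mono {m n : ℕ} (h : m ≤ n) : serLT K r m ≤ serLT K r n :=
  coeffsIn_mono (suppIn_mono (expLT_mono h))

lemma yConst_mem_serLT (a : MvPowerSeries ℕ+ K) (m : ℕ) : yConst K r a ∈ serLT K r m := by
  intro b
  rw [yConst, MvPowerSeries.coeff_map]
  exact C_mem_suppIn _ _

lemma zY_mem_serLT {α : Fin r} {m : ℕ} (h : (α : ℕ) < m) (k : ℤ) : zY K α k ∈ serLT K r m := by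
  refine C_mem_coeffsIn (single_mem_suppIn ?_ _)
  intro j hj
  refine Pi.single_eq_of_ne (M := fun _ => ℤ) ?_ k
  rintro rfl
  omega

lemma zY_neg_one_mem_serNonpos (μ : Fin r) : zY K μ (-1) ∈ serNonpos K μ := by
  refine C_mem_coeffsIn (single_mem_suppIn (S := expNonpos μ) (And.intro ?_ fun j hj => ?_) _)
  · change Pi.single (M := fun _ => ℤ) μ (-1) μ ≤ 0
    simp
  · exact Pi.single_eq_of_ne (M := fun _ => ℤ) hj.ne' _

lemma yConstTerm_zY_mul (α : Fin r) (k : ℤ) (F : YZ K r) (b : ℕ+ →₀ ℕ) :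
    MvPowerSeries.coeff b (yConstTerm K r (zY K α k * F)) =
      (MvPowerSeries.coeff b F).coeff (toLex (Pi.single α (-k))) := by
  rw [coeff_yConstTerm, zY, MvPowerSeries.coeff_C_mul, zK, HahnSeries.coeff_single_mul, one_mul,
    zero_sub, ← toLex_neg, Pi.single_neg]

lemma yConstTerm_zY_neg_mul {μ : Fin r} {X : YZ K r} (hX : X ∈ serNonpos K μ) :
    yConstTerm K r (zY K μ (-1) * X) = 0 := by
  ext b
  rw [yConstTerm_zY_mul, map_zero]
  refine coeff_eq_zero_of_suppIn (hX b) fun h => ?_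
  have h1 : Pi.single (M := fun _ => ℤ) μ (- -1) μ ≤ 0 := h.1
  simp at h1

/-- `X` expands in `1 / z_μ` as the power series `φ`, as far as constant terms can tell. -/
def Expands (μ : Fin r) (X : YZ K r) (φ : PowerSeries (YZ K r)) : Prop :=
  X ∈ serNonpos K μ ∧ ∀ f ∈ serLT K r μ, ∀ l : ℕ,
    yConstTerm K r (f * zY K μ 1 ^ l * X) = yConstTerm K r (f * PowerSeries.coeff l φ)

/-- Multiplication by `1/z_μ` shifts coefficients by one. At `l = 0` the shifted term has only
negative powers of `z_μ` and no constant term. -/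
lemma Expands.one_sub_mul {μ : Fin r} {X : YZ K r} {φ : PowerSeries (YZ K r)}
    (h : Expands μ X φ) {a : YZ K r} (ha : a ∈ serLT K r μ) :
    Expands μ ((1 - a * zY K μ (-1)) * X) ((1 - PowerSeries.C a * PowerSeries.X) * φ) := by
  have hz := zY_one_mul_zY_neg_one (K := K) μ
  refine ⟨Subring.mul_mem _ (Subring.sub_mem _ (Subring.one_mem _) (Subring.mul_mem _
    (serLT_le_serNonpos μ ha) (zY_neg_one_mem_serNonpos μ))) h.1, fun f hf l => ?_⟩
  rw [sub_mul 1 (PowerSeries.C a * _), one_mul, mul_assoc (PowerSeries.C a), map_sub,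
    PowerSeries.coeff_C_mul]
  rcases l with _ | l
  · rw [PowerSeries.coeff_zero_X_mul, mul_zero, sub_zero, ← h.2 f hf 0]
    have := yConstTerm_zY_neg_mul (Subring.mul_mem _ (serLT_le_serNonpos μ
      (Subring.mul_mem _ hf ha)) h.1)
    rw [← sub_zero (yConstTerm K r (f * _ * X)), ← this, ← map_sub]
    congr 1
    ring
  · rw [PowerSeries.coeff_succ_X_mul, mul_sub, map_sub, ← h.2 f hf, ← mul_assoc f a,
      ← h.2 _ (Subring.mul_mem _ hf ha), ← map_sub]
    congr 1
    rw [pow_succ]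
    linear_combination (-f * a * zY K μ 1 ^ l * X) * hz

/-- The converse, which allows division by `1 - a / z_μ`. The induction on `l` must vary `f`, as
each step replaces `f` by `f * a`. -/
lemma Expands.of_one_sub_mul {μ : Fin r} {X X' : YZ K r} {φ φ' : PowerSeries (YZ K r)}
    (h : Expands μ X φ) {a : YZ K r} (ha : a ∈ serLT K r μ) (hX' : X' ∈ serNonpos K μ)
    (hX : (1 - a * zY K μ (-1)) * X' = X)
    (hφ : (1 - PowerSeries.C a * PowerSeries.X) * φ' = φ) :
    Expands μ X' φ' := by
  have hz := zY_one_mul_zY_neg_one (K := K) μ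
  refine ⟨hX', fun f hf l => ?_⟩
  induction l generalizing f with
  | zero =>
    have h1 := h.2 f hf 0
    rw [← hφ, sub_mul, one_mul, mul_assoc (PowerSeries.C a), map_sub, PowerSeries.coeff_C_mul,
      PowerSeries.coeff_zero_X_mul, mul_zero, sub_zero] at h1
    have := yConstTerm_zY_neg_mul (Subring.mul_mem _ (serLT_le_serNonpos μ
      (Subring.mul_mem _ hf ha)) hX')
    rw [← h1, ← sub_zero (yConstTerm K r (f * _ * X')), ← this, ← map_sub, ← hX]
    congr 1
    ring
  | succ l ih =>
    have h1 := h.2 f hf (l + 1)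
    rw [← hφ, sub_mul, one_mul, mul_assoc (PowerSeries.C a), map_sub, PowerSeries.coeff_C_mul,
      PowerSeries.coeff_succ_X_mul, mul_sub, map_sub, ← mul_assoc f a,
      ← ih _ (Subring.mul_mem _ hf ha), eq_sub_iff_add_eq, ← map_add] at h1
    rw [← h1, ← hX]
    congr 1
    rw [pow_succ]
    linear_combination (f * a * zY K μ 1 ^ l * X') * hz

/-- The series `G(Y₁ / z_μ, Y₂ / z_μ², …)`. -/
def atInv (μ : Fin r) (G : MvPowerSeries ℕ+ K) : YZ K r :=
  MvPowerSeries.rescale (fun n : ℕ+ => zK K μ (-1) ^ (n : ℕ)) (yConst K r G)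

lemma coeff_atInv (μ : Fin r) (G : MvPowerSeries ℕ+ K) (b : ℕ+ →₀ ℕ) :
    MvPowerSeries.coeff b (atInv μ G) =
      HahnSeries.single (toLex (Pi.single μ (-(wt b : ℤ)))) (MvPowerSeries.coeff b G) := by
  rw [atInv, MvPowerSeries.coeff_rescale, prod_pow_eq_pow_wt, yConst, MvPowerSeries.coeff_map,
    zK_pow, zK, HahnSeries.C_apply, HahnSeries.single_mul_single, add_zero, one_mul, mul_neg_one]

lemma expands_atInv (μ : Fin r) (G : MvPowerSeries ℕ+ K) :
    Expands μ (atInv μ G) (PowerSeries.map (yConst K r) (wtSeries G)) := by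
  classical
  refine ⟨fun b => ?_, fun f hf l => ?_⟩
  · rw [coeff_atInv]
    refine single_mem_suppIn (S := expNonpos μ) (And.intro ?_ fun j hj => ?_) _
    · change Pi.single (M := fun _ => ℤ) μ (-(wt b : ℤ)) μ ≤ 0
      simp
    · exact Pi.single_eq_of_ne (M := fun _ => ℤ) hj.ne' _
  · have hl : zY K μ 1 ^ l = zY K μ l := by rw [zY, ← map_pow, zK_pow, mul_one, zY]
    rw [hl, mul_comm f, mul_assoc]
    ext b
    rw [yConstTerm_zY_mul, PowerSeries.coeff_map, coeff_yConstTerm, MvPowerSeries.coeff_mul,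
      MvPowerSeries.coeff_mul]
    refine (map_sum (HahnSeries.coeff.addMonoidHom _) _ _).trans ((Finset.sum_congr rfl
      fun p _ => ?_).trans (map_sum (HahnSeries.coeff.addMonoidHom _) _ _).symm)
    change (MvPowerSeries.coeff p.1 f * _).coeff _ = (MvPowerSeries.coeff p.1 f * _).coeff 0
    rw [coeff_atInv, HahnSeries.coeff_mul_single, yConst, MvPowerSeries.coeff_map,
      coeff_coeff_wtSeries, HahnSeries.C_apply, HahnSeries.coeff_mul_single_zero, ← toLex_sub,
      ← Pi.single_sub]
    -- `f` is free of `z_μ`, so only the monomials of `G` of weight exactly `l` can cancel `z_μ^l`.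
    split_ifs with hp
    · rw [hp, sub_self, Pi.single_zero]
      rfl
    · rw [mul_zero, coeff_eq_zero_of_suppIn (hf p.1), zero_mul]
      intro h
      have h1 : Pi.single (M := fun _ => ℤ) μ (-(l : ℤ) - -(wt p.2 : ℤ)) μ = 0 := h μ le_rfl
      rw [Pi.single_eq_same] at h1
      omega

/-- Each `F i` is known only through its defining equation as the quotient `(1 - a i / z_μ) / (1 - c
i / z_μ)`; it is adjoined by one multiplication and one division. -/
lemma Expands.mul_prod {μ : Fin r} {X : YZ K r} {φ : PowerSeries (YZ K r)}
    (h : Expands μ X φ) {ι : Type*} (s : Finset ι) (F a c : ι → YZ K r)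
    (hF : ∀ i ∈ s, F i ∈ serNonpos K μ) (ha : ∀ i ∈ s, a i ∈ serLT K r μ)
    (hc : ∀ i ∈ s, c i ∈ serLT K r μ)
    (hFac : ∀ i ∈ s, (1 - c i * zY K μ (-1)) * F i = 1 - a i * zY K μ (-1)) :
    Expands μ (X * ∏ i ∈ s, F i)
      (φ * ∏ i ∈ s, (1 - PowerSeries.C (a i) * PowerSeries.X) * geom (c i)) := by
  classical
  induction s using Finset.induction_on with
  | empty => simpa using h
  | insert i s hi ih =>
    have ih' := ih (fun j hj => hF j (Finset.mem_insert_of_mem hj))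
      (fun j hj => ha j (Finset.mem_insert_of_mem hj))
      (fun j hj => hc j (Finset.mem_insert_of_mem hj))
      (fun j hj => hFac j (Finset.mem_insert_of_mem hj))
    have hi' := Finset.mem_insert_self i s
    rw [Finset.prod_insert hi, Finset.prod_insert hi]
    refine (ih'.one_sub_mul (ha i hi')).of_one_sub_mul (hc i hi') ?_ ?_ ?_
    · rw [mul_left_comm]
      exact Subring.mul_mem _ (hF i hi') ih'.1
    · rw [← hFac i hi']
      ring
    · linear_combination ((1 - PowerSeries.C (a i) * PowerSeries.X) * φ * ∏ i ∈ s,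
        (1 - PowerSeries.C (a i) * PowerSeries.X) * geom (c i)) * one_sub_mul_geom (c i)

/-- Taking the constant term in one variable. -/
lemma Expands.yConstTerm_mul_coeff {μ : Fin r} {X : YZ K r} {Q : PowerSeries (YZ K r)}
    (h : Expands μ X Q) {s t : K} (hst : s * t = 1) (hQ : PowerSeries.constantCoeff Q = 1)
    {B : PowerSeries (YZ K r)} (hBm : ∀ n, PowerSeries.coeff n B ∈ serLT K r μ)
    (hB : B = Q * PowerSeries.rescale (yConst K r (MvPowerSeries.C t)) B)
    {Y : YZ K r} (hY : Y ∈ serLT K r μ) (k : ℕ) :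
    yConstTerm K r (Y * (zY K μ 1 * X) * PowerSeries.coeff k
        (B * geom (yConst K r (MvPowerSeries.C s) * zY K μ 1))) =
      MvPowerSeries.C (s ^ k * (1 - t ^ (k + 1))) *
        yConstTerm K r (Y * PowerSeries.coeff (k + 1) B) := by
  have hst' : yConst K r (MvPowerSeries.C s) * yConst K r (MvPowerSeries.C t) = 1 := by
    rw [← map_mul, ← map_mul, hst, map_one, map_one]
  have hc : yConst K r (MvPowerSeries.C (s ^ k * (1 - t ^ (k + 1)))) =
      yConst K r (MvPowerSeries.C s) ^ k * (1 - yConst K r (MvPowerSeries.C t) ^ (k + 1)) := by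
    simp only [map_mul, map_sub, map_one, map_pow]
  rw [← yConstTerm_mul, hc]
  exact map_mul_coeff_mul_geom (yConstTerm K r) (serLT K r μ) h.2 hst'
    (yConst_mem_serLT _ _) hQ hBm hB hY k

end Elimination

/-! ### Elimination of all the variables -/

section FullElimination

variable {K : Type*} [Field K] {r : ℕ}

lemma mem_coeffsIn_iff {A : Type*} [CommRing A] {T : Subring A} {F : PowerSeries A} :
    F ∈ (coeffsIn T : Subring (MvPowerSeries Unit A)) ↔ ∀ n, PowerSeries.coeff n F ∈ T := by
  refine ⟨fun h n => h _, fun h b => ?_⟩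
  have := h (b ())
  rwa [PowerSeries.coeff_def (s := b) rfl] at this

/-- The series `B(u) * ∏_{α < m} 1 / (1 - s z_α u)`. -/
def dressed (r : ℕ) (s : K) (B : PowerSeries (MvPowerSeries ℕ+ K)) (m : ℕ) :
    PowerSeries (YZ K r) :=
  PowerSeries.map (yConst K r) B *
    ∏ j ∈ Finset.univ.filter fun j : Fin r => (j : ℕ) < m,
      geom (yConst K r (MvPowerSeries.C s) * zY K j 1)

lemma coeff_dressed_mem (s : K) (B : PowerSeries (MvPowerSeries ℕ+ K)) (m n : ℕ) :
    PowerSeries.coeff n (dressed r s B m) ∈ serLT K r m := by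
  revert n
  rw [← mem_coeffsIn_iff, dressed]
  refine Subring.mul_mem _ (mem_coeffsIn_iff.mpr fun n => ?_)
    (Subring.prod_mem _ fun j hj => mem_coeffsIn_iff.mpr fun n => ?_)
  · rw [PowerSeries.coeff_map]
    exact yConst_mem_serLT _ _
  · rw [geom, PowerSeries.coeff_mk]
    exact Subring.pow_mem _ (Subring.mul_mem _ (yConst_mem_serLT _ _)
      (zY_mem_serLT (Finset.mem_filter.mp hj).2 1)) _

lemma filter_lt_succ (μ : Fin r) :
    (Finset.univ.filter fun j : Fin r => (j : ℕ) < μ + 1) =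
      insert μ (Finset.univ.filter fun j : Fin r => (j : ℕ) < μ) := by
  ext j
  simp only [Finset.mem_filter, Finset.mem_univ, true_and, Finset.mem_insert, Fin.ext_iff]
  omega

lemma dressed_succ (s : K) (B : PowerSeries (MvPowerSeries ℕ+ K)) (μ : Fin r) :
    dressed r s B (μ + 1) =
      dressed r s B μ * geom (yConst K r (MvPowerSeries.C s) * zY K μ 1) := by
  rw [dressed, dressed, filter_lt_succ, Finset.prod_insert (by simp), mul_assoc]
  congr 1
  rw [mul_comm]

/-- Replacing `u` by `t u` turns `1 / (1 - s z_i u)` into `1 / (1 - z_i u)`, which the numerators `1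
- z_i u` cancel. -/
lemma dressed_eq {s t : K} (hst : s * t = 1) {B Q : PowerSeries (MvPowerSeries ℕ+ K)}
    (hB : B = Q * PowerSeries.rescale (MvPowerSeries.C t) B) (μ : Fin r) :
    dressed r s B μ = (PowerSeries.map (yConst K r) Q * ∏ i ∈ Finset.Iio μ,
        (1 - PowerSeries.C (zY K i 1) * PowerSeries.X) *
          geom (yConst K r (MvPowerSeries.C s) * zY K i 1)) *
      PowerSeries.rescale (yConst K r (MvPowerSeries.C t)) (dressed r s B μ) := by
  have hIio : (Finset.univ.filter fun j : Fin r => (j : ℕ) < μ) = Finset.Iio μ := by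
    ext j
    rw [Finset.mem_filter, Finset.mem_Iio, Fin.lt_def]
    simp
  have hst' : yConst K r (MvPowerSeries.C t) * yConst K r (MvPowerSeries.C s) = 1 := by
    rw [← map_mul, ← map_mul, mul_comm, hst, map_one, map_one]
  have hgeom : (∏ i ∈ Finset.Iio μ, (1 - PowerSeries.C (zY K i 1) * PowerSeries.X)) *
      ∏ i ∈ Finset.Iio μ, geom (zY K i 1) = 1 := by
    rw [← Finset.prod_mul_distrib]
    exact Finset.prod_eq_one fun i _ => one_sub_mul_geom _
  have hmap : PowerSeries.map (yConst K r) B = PowerSeries.map (yConst K r) Q *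
      PowerSeries.rescale (yConst K r (MvPowerSeries.C t)) (PowerSeries.map (yConst K r) B) := by
    conv_lhs => rw [hB, map_mul, ← PowerSeries.rescale_map]
  rw [dressed, hIio, map_mul, map_prod, Finset.prod_mul_distrib]
  simp only [rescale_geom, ← mul_assoc, hst', one_mul]
  conv_lhs => rw [hmap, ← mul_one (PowerSeries.map (yConst K r) Q *
      PowerSeries.rescale (yConst K r (MvPowerSeries.C t)) (PowerSeries.map (yConst K r) B)),
    ← hgeom]
  ring

/-- The elimination of all variables `z_α` from a constant term of Hall-Littlewood type. -/
theorem yConstTerm_prod {s t : K} (hst : s * t = 1) (G a : MvPowerSeries ℕ+ K)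
    (F : Fin r → Fin r → YZ K r)
    (hFm : ∀ i j, i < j → F i j ∈ serNonpos K j)
    (hF : ∀ i j, i < j →
      (1 - yConst K r (MvPowerSeries.C s) * zY K i 1 * zY K j (-1)) * F i j =
        1 - zY K i 1 * zY K j (-1))
    {B : PowerSeries (MvPowerSeries ℕ+ K)} (hB1 : PowerSeries.constantCoeff B = 1)
    (hG1 : PowerSeries.constantCoeff (wtSeries G) = 1)
    (hB : B = (1 - PowerSeries.C a * PowerSeries.X) * wtSeries G *
      PowerSeries.rescale (MvPowerSeries.C t) B) :
    yConstTerm K r (∏ j : Fin r, zY K j 1 * ((1 - yConst K r a * zY K j (-1)) * atInv j G *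
        ∏ i ∈ Finset.Iio j, F i j)) =
      MvPowerSeries.C (∏ i ∈ Finset.range r, s ^ i * (1 - t ^ (i + 1))) *
        PowerSeries.coeff r B := by
  set X : Fin r → YZ K r := fun j => (1 - yConst K r a * zY K j (-1)) * atInv j G *
    ∏ i ∈ Finset.Iio j, F i j with hX
  set Qt : PowerSeries (MvPowerSeries ℕ+ K) :=
    (1 - PowerSeries.C a * PowerSeries.X) * wtSeries G with hQt
  set Q : Fin r → PowerSeries (YZ K r) := fun μ =>
    PowerSeries.map (yConst K r) Qt * ∏ i ∈ Finset.Iio μ,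
        (1 - PowerSeries.C (zY K i 1) * PowerSeries.X) *
          geom (yConst K r (MvPowerSeries.C s) * zY K i 1) with hQ
  have hexp : ∀ μ, Expands μ (X μ) (Q μ) := by
    intro μ
    have h1 : Expands μ ((1 - yConst K r a * zY K μ (-1)) * atInv μ G)
        (PowerSeries.map (yConst K r) Qt) := by
      have := (expands_atInv μ G).one_sub_mul (yConst_mem_serLT a μ)
      rwa [hQt, map_mul, map_sub, map_mul, PowerSeries.map_C, PowerSeries.map_X, map_one]
    refine h1.mul_prod _ (fun i => F i μ) (fun i => zY K i 1)
      (fun i => yConst K r (MvPowerSeries.C s) * zY K i 1)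
      (fun i hi => hFm i μ (Finset.mem_Iio.mp hi))
      (fun i hi => zY_mem_serLT (Fin.lt_def.mp (Finset.mem_Iio.mp hi)) 1)
      (fun i hi => Subring.mul_mem _ (yConst_mem_serLT _ _)
        (zY_mem_serLT (Fin.lt_def.mp (Finset.mem_Iio.mp hi)) 1))
      (fun i hi => hF i μ (Finset.mem_Iio.mp hi))
  have hQ1 : ∀ μ, PowerSeries.constantCoeff (Q μ) = 1 := by
    intro μ
    have h1 : PowerSeries.constantCoeff (PowerSeries.map (yConst K r) Qt) = 1 := by
      rw [← PowerSeries.coeff_zero_eq_constantCoeff_apply, PowerSeries.coeff_map,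
        PowerSeries.coeff_zero_eq_constantCoeff_apply, hQt, map_mul, hG1]
      simp
    rw [hQ, map_mul, h1, map_prod, one_mul]
    refine Finset.prod_eq_one fun i _ => ?_
    rw [map_mul]
    simp [constantCoeff_geom]
  have hmem : ∀ m : ℕ, (∏ j ∈ Finset.univ.filter fun j : Fin r => (j : ℕ) < m,
      zY K j 1 * X j) ∈ serLT K r m := by
    intro m
    refine Subring.prod_mem _ fun j hj => ?_
    have hjm := (Finset.mem_filter.mp hj).2
    exact Subring.mul_mem _ (zY_mem_serLT hjm 1)
      (serLT_mono (Nat.succ_le_of_lt hjm) (serNonpos_le_serLT j (hexp j).1))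
  -- With `m` variables left, removing the last one lowers `m` and raises `k` by one, so `k` is
  -- universally quantified.
  have main : ∀ m : ℕ, m ≤ r → ∀ k : ℕ,
      yConstTerm K r ((∏ j ∈ Finset.univ.filter fun j : Fin r => (j : ℕ) < m, zY K j 1 * X j) *
        PowerSeries.coeff k (dressed r s B m)) =
      MvPowerSeries.C (∏ i ∈ Finset.range m, s ^ (k + i) * (1 - t ^ (k + i + 1))) *
        PowerSeries.coeff (k + m) B := by
    intro m
    induction m with
    | zero =>
      intro _ k
      simp only [not_lt_zero, Finset.filter_false, Finset.prod_empty, one_mul, dressed, mul_one,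
        Finset.range_zero, map_one, add_zero, PowerSeries.coeff_map, yConstTerm_yConst]
    | succ m ih =>
      intro hm k
      have hstep := (hexp ⟨m, hm⟩).yConstTerm_mul_coeff hst (hQ1 _)
        (fun n => coeff_dressed_mem s B m n) (dressed_eq hst hB ⟨m, hm⟩) (hmem m) k
      have h1 := filter_lt_succ (⟨m, hm⟩ : Fin r)
      have h2 := dressed_succ s B (⟨m, hm⟩ : Fin r)
      simp only at h1 h2
      rw [h1, h2, Finset.prod_insert (by simp), mul_comm (zY K _ 1 * X _), hstep,
        ih (by omega) (k + 1), ← mul_assoc, ← map_mul, Finset.prod_range_succ', add_zero,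
        mul_comm (s ^ k * _)]
      congr 2
      · congr 2
        funext i
        rw [show k + 1 + i = k + (i + 1) by omega]
      · rw [show k + 1 + m = k + (m + 1) by omega]
  -- At `m = r`, `k = 0` the dressed coefficient is 1, so `main` applies to the bare product.
  have hd1 : PowerSeries.coeff 0 (dressed r s B r) = 1 := by
    rw [PowerSeries.coeff_zero_eq_constantCoeff_apply, dressed, map_mul, map_prod,
      Finset.prod_eq_one, mul_one, ← PowerSeries.coeff_zero_eq_constantCoeff_apply,
      PowerSeries.coeff_map, PowerSeries.coeff_zero_eq_constantCoeff_apply, hB1, map_one]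
    intro i _
    simp [constantCoeff_geom]
  have := main r le_rfl 0
  rw [hd1, mul_one] at this
  simpa using this

end FullElimination

/-! ### `phiMinus` as a translation of the power sums -/

section Taylor

variable {K : Type*} [Field K]

/-- Only two terms of the Leibniz formula survive, since `D` kills `x` after two steps. -/
lemma iterate_succ_mul {A : Type*} [CommRing A] [Algebra K A] (D : Derivation K A A) {x : A}
    (hx : D (D x) = 0) (F : A) (k : ℕ) :
    D^[k + 1] (F * x) = D^[k + 1] F * x + ((k : A) + 1) * (D^[k] F * D x) := by
  induction k with
  | zero =>
    simp only [zero_add, Function.iterate_one, Function.iterate_zero, id_eq, Nat.cast_zero,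
      one_mul, D.leibniz, smul_eq_mul]
    ring
  | succ k ih =>
    rw [Function.iterate_succ_apply', ih, map_add, D.leibniz, D.leibniz, D.leibniz, hx, map_add,
      D.map_natCast, D.map_one_eq_zero, ← Function.iterate_succ_apply' D,
      ← Function.iterate_succ_apply' D]
    push_cast
    simp only [smul_eq_mul, add_zero, Nat.succ_eq_add_one]
    ring

variable {r : ℕ}

lemma phiDer_X_inl (q : K) (n : ℕ+) : phiDer r q (MvPolynomial.X (Sum.inl n)) =
    MvPolynomial.C (q ^ (n : ℕ) - 1) *
      ∑ α : Fin r, MvPolynomial.X (Sum.inr α) ^ (n : ℕ) := by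
  simp [phiDer, MvPolynomial.mkDerivation_X]

lemma phiDer_X_inr (q : K) (α : Fin r) : phiDer r q (MvPolynomial.X (Sum.inr α)) = 0 := by
  simp [phiDer, MvPolynomial.mkDerivation_X]

lemma phiDer_phiDer_X_inl (q : K) (n : ℕ+) :
    phiDer r q (phiDer r q (MvPolynomial.X (Sum.inl n))) = 0 := by
  rw [phiDer_X_inl, Derivation.leibniz, map_sum]
  simp [phiDer_X_inr, Derivation.leibniz_pow, ← MvPolynomial.algebraMap_eq]

/-- The translation of the power sums `p_n` by the value of `phiDer` on them. -/
def phiShift (r : ℕ) (q : K) : SymF K →ₐ[K] MvPolynomial (ℕ+ ⊕ Fin r) K :=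
  MvPolynomial.aeval fun n =>
    MvPolynomial.X (Sum.inl n) + phiDer r q (MvPolynomial.X (Sum.inl n))

variable [CharZero K]

/-- Taylor's formula: the exponential of a derivation is multiplicative, and `D² p_n = 0` makes it a
translation on generators. The unspecified bound `N₀` lets the induction avoid tracking degrees. -/
lemma exists_sum_phiDer_eq (q : K) (f : SymF K) : ∃ N₀ : ℕ, ∀ N ≥ N₀,
    ∑ k ∈ Finset.range N, (1 / (k.factorial : K)) •
      (phiDer r q)^[k] (MvPolynomial.rename Sum.inl f) = phiShift r q f := by
  induction f using MvPolynomial.induction_on with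
  | C a =>
    refine ⟨1, fun N hN => ?_⟩
    obtain ⟨M, rfl⟩ := Nat.exists_eq_add_of_le' hN
    rw [Finset.sum_range_succ', Finset.sum_eq_zero]
    · simp [phiShift, MvPolynomial.algebraMap_eq]
    · intro k _
      rw [MvPolynomial.rename_C, Function.iterate_succ_apply, ← MvPolynomial.algebraMap_eq,
        Derivation.map_algebraMap, iterate_map_zero, smul_zero]
  | add f g hf hg =>
    obtain ⟨N₁, h₁⟩ := hf
    obtain ⟨N₂, h₂⟩ := hg
    refine ⟨max N₁ N₂, fun N hN => ?_⟩
    rw [map_add, map_add, ← h₁ N ((le_max_left _ _).trans hN),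
      ← h₂ N ((le_max_right _ _).trans hN), ← Finset.sum_add_distrib]
    refine Finset.sum_congr rfl fun k _ => ?_
    rw [iterate_map_add, smul_add]
  | mul_X f n hf =>
    obtain ⟨N₀, h₀⟩ := hf
    refine ⟨N₀ + 1, fun N hN => ?_⟩
    obtain ⟨M, rfl⟩ := Nat.exists_eq_add_of_le' (le_trans (Nat.le_add_left 1 N₀) hN)
    have hM : N₀ ≤ M := by omega
    rw [map_mul, map_mul, MvPolynomial.rename_X, Finset.sum_range_succ']
    have hterm : ∀ k : ℕ, (1 / ((k + 1).factorial : K)) •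
        (phiDer r q)^[k + 1] (MvPolynomial.rename Sum.inl f * MvPolynomial.X (Sum.inl n)) =
        ((1 / ((k + 1).factorial : K)) • (phiDer r q)^[k + 1] (MvPolynomial.rename Sum.inl f)) *
          MvPolynomial.X (Sum.inl n) +
        ((1 / (k.factorial : K)) • (phiDer r q)^[k] (MvPolynomial.rename Sum.inl f)) *
          phiDer r q (MvPolynomial.X (Sum.inl n)) := by
      intro k
      rw [iterate_succ_mul _ (phiDer_phiDer_X_inl q n), smul_add, smul_mul_assoc, smul_mul_assoc]
      congr 1
      rw [show ((k : MvPolynomial (ℕ+ ⊕ Fin r) K) + 1) = algebraMap K _ ((k : K) + 1) by simp,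
        ← Algebra.smul_def, smul_smul, Nat.factorial_succ]
      congr 1
      have h1 : ((k : K) + 1) ≠ 0 := by exact_mod_cast k.succ_ne_zero
      have h2 : (k.factorial : K) ≠ 0 := by exact_mod_cast k.factorial_ne_zero
      push_cast
      field_simp
    rw [Finset.sum_congr rfl fun k _ => hterm k, Finset.sum_add_distrib, ← Finset.sum_mul,
      ← Finset.sum_mul, h₀ M hM]
    have h3 := h₀ (M + 1) (by omega)
    rw [Finset.sum_range_succ'] at h3
    simp only [Function.iterate_zero, id_eq, Nat.factorial_zero, Nat.cast_one, div_one,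
      one_smul] at h3 ⊢
    rw [← h3, phiShift, MvPolynomial.aeval_X]
    ring

/-- `phiMinus` as a ring homomorphism: the translation `p_n ↦ p_n + (q^n - 1) ∑ z_α^{-n}`. -/
def phiMinusHom (r : ℕ) (q : K) : SymF K →+* ZSeries K r :=
  ((MvPolynomial.aeval (Sum.elim (fun n => HahnSeries.C (MvPolynomial.X n))
    (fun α => zpw α (-1))) : MvPolynomial (ℕ+ ⊕ Fin r) K →ₐ[K] ZSeries K r).comp
      (phiShift r q)).toRingHom

lemma phiMinus_eq (q : K) (f : SymF K) : phiMinus r q f = phiMinusHom r q f := by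
  obtain ⟨N₀, h₀⟩ := exists_sum_phiDer_eq (r := r) q f
  rw [phiMinus]
  have h1 : ∑ k ∈ Finset.range (f.totalDegree + 1), (1 / (k.factorial : K)) •
      (phiDer r q)^[k] (MvPolynomial.rename Sum.inl f) = phiShift r q f := by
    -- Both truncations agree with a longer one, whose extra terms vanish for degree reasons.
    rw [← h₀ (max N₀ (f.totalDegree + 1)) (le_max_left _ _)]
    refine Finset.sum_subset (Finset.range_mono (le_max_right _ _)) fun k _ hk => ?_
    rw [phiDer_iterate_eq_zero q f, smul_zero]
    rw [Finset.mem_range] at hk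
    omega
  rw [h1]
  rfl

omit [CharZero K] in
lemma phiMinusHom_C_mul_X (q a : K) (n : ℕ+) :
    phiMinusHom r q (MvPolynomial.C a * MvPolynomial.X n) =
      HahnSeries.C (MvPolynomial.C a) * (HahnSeries.C (MvPolynomial.X n) +
        HahnSeries.C (MvPolynomial.C (q ^ (n : ℕ) - 1)) * ∑ α : Fin r, zpw α (-1) ^ (n : ℕ)) := by
  have hC : ∀ b : K, algebraMap K (ZSeries K r) b = HahnSeries.C (MvPolynomial.C b) := fun b => by
    rw [HahnSeries.algebraMap_apply, MvPolynomial.algebraMap_eq]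
  rw [map_mul]
  congr 1
  · rw [← hC, ← MvPolynomial.algebraMap_eq]
    exact AlgHom.commutes _ a
  · change MvPolynomial.aeval _ (phiShift r q (MvPolynomial.X n)) = _
    rw [phiShift, MvPolynomial.aeval_X, phiDer_X_inl, map_add, map_mul, map_sum]
    simp only [MvPolynomial.aeval_X, map_pow, Sum.elim_inl, Sum.elim_inr, MvPolynomial.aeval_C, hC]

end Taylor

/-! ### The factors of `Delta` -/

section Factors

variable {K : Type*} [Field K] [CharZero K] {r : ℕ}

/-- The ratio `z_α / z_β` over `K`. -/
def zratioK (K : Type*) [Field K] {r : ℕ} (α β : Fin r) : HahnSeries (Lex (Fin r → ℤ)) K :=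
  zK K α 1 * zK K β (-1)

omit [CharZero K] in
lemma hmap_zpw (f : SymF K →+* K) (α : Fin r) (k : ℤ) : hmap f (zpw α k) = zK K α k := by
  rw [zpw, zK, hmap_single, map_one]

omit [CharZero K] in
lemma hmap_zratio (f : SymF K →+* K) (α β : Fin r) : hmap f (zratio α β) = zratioK K α β := by
  rw [← zpw_mul_zpw, map_mul, hmap_zpw, hmap_zpw, zratioK]

lemma hexp_sum_heval {ι : Type*} (S : Finset ι) (x : ι → ZSeries K r) (c : ι → ℕ+ → SymF K)
    (hx : ∀ i ∈ S, 0 < (x i).orderTop) (f : SymF K →+* K) :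
    hmap f (zexp (∑ i ∈ S, zsum (c i) (x i))) =
      ∏ i ∈ S, PowerSeries.heval (hmap f (x i)) (expSum fun n => f (c i n)) := by
  have hpos : ∀ i ∈ S, 0 < (zsum (c i) (x i)).orderTop := fun i hi =>
    orderTop_heval_pos (hx i hi) (constantCoeff_sumPos _)
  change hmap f (hexp _) = _
  rw [hexp_sum S _ hpos, map_prod]
  refine Finset.prod_congr rfl fun i hi => ?_
  rw [zsum, hexp_heval_sumPos (hx i hi), hmap_heval f (hx i hi), map_expSum]

/-- The factor `(1 - z_α / z_β) / (1 - s z_α / z_β)`. -/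
def deltaFactor (s : K) (α β : Fin r) : HahnSeries (Lex (Fin r → ℤ)) K :=
  PowerSeries.heval (zratioK K α β) (expSum fun n => -((1 - s ^ (n : ℕ)) / (n : K)))

omit [CharZero K] in
lemma neg_zsum (c : ℕ+ → SymF K) (w : ZSeries K r) : -zsum c w = zsum (-c) w := by
  rw [zsum, zsum, ← map_neg]
  congr 1
  exact sumPos_ext (by simp [constantCoeff_sumPos]) (by simp [coeff_sumPos])

lemma hmap_Delta (f : SymF K →+* K) (hf : ∀ a, f (MvPolynomial.C a) = a) (s : K) :
    hmap f (Delta r s) = ∏ β : Fin r, ∏ α ∈ Finset.Iio β, deltaFactor s α β := by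
  -- The pairs are regrouped by the larger index, the variable with negative exponent, which is
  -- eliminated first.
  have h1 : (-∑ α : Fin r, ∑ β ∈ Finset.Ioi α,
      zsum (fun n => MvPolynomial.C ((1 - s ^ (n : ℕ)) / (n : K))) (zratio α β) : ZSeries K r) =
      ∑ p ∈ (Finset.univ.sigma fun β : Fin r => Finset.Iio β),
        zsum (fun n => MvPolynomial.C (-((1 - s ^ (n : ℕ)) / (n : K)))) (zratio p.2 p.1) := by
    rw [Finset.sum_sigma, Finset.sum_comm' (t' := Finset.univ) (s' := fun β => Finset.Iio β)
      (by simp), ← Finset.sum_neg_distrib]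
    refine Finset.sum_congr rfl fun β _ => ?_
    rw [← Finset.sum_neg_distrib]
    refine Finset.sum_congr rfl fun α _ => ?_
    rw [neg_zsum]
    congr 1
    funext n
    rw [Pi.neg_apply, map_neg]
  rw [Delta, h1, hexp_sum_heval _ _ _ (fun p hp => zratio_order_pos
    (Finset.mem_Iio.mp (Finset.mem_sigma.mp hp).2)), Finset.prod_sigma]
  simp only [hf, hmap_zratio, deltaFactor]

lemma rat_inv_eq (n : ℕ) : algebraMap ℚ K (1 / (n : ℚ)) = 1 / (n : K) := by
  simp

/-- The exponent is `log (1 - w) - log (1 - s w)`. -/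
lemma one_sub_mul_expSum (s : K) :
    (1 - PowerSeries.C s * PowerSeries.X) *
      expSum (fun n : ℕ+ => -((1 - s ^ (n : ℕ)) / (n : K))) = 1 - PowerSeries.X := by
  have h1 := expSum_neg_log s
  have h2 := expSum_neg_log (1 : K)
  rw [map_one, one_mul] at h2
  rw [← h1, ← h2, ← expSum_add]
  congr 1
  funext n
  rw [Pi.add_apply, rat_inv_eq, one_pow]
  ring

omit [CharZero K] in
lemma zratioK_order_pos {α β : Fin r} (h : α < β) : 0 < (zratioK K α β).orderTop := by
  rw [← hmap_zratio (MvPolynomial.eval 0)]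
  exact orderTop_hmap_pos _ (zratio_order_pos h)

lemma one_sub_mul_deltaFactor (s : K) {α β : Fin r} (h : α < β) :
    (1 - HahnSeries.C s * zratioK K α β) * deltaFactor s α β = 1 - zratioK K α β := by
  have h1 := congrArg (PowerSeries.heval (zratioK K α β)) (one_sub_mul_expSum s)
  rw [map_mul, map_sub, map_sub, map_mul, map_one, PowerSeries.heval_X _ (zratioK_order_pos h),
    PowerSeries.heval_C] at h1
  rw [← h1, deltaFactor, HahnSeries.C_eq_algebraMap, Algebra.algebraMap_eq_smul_one]

lemma deltaFactor_mem (s : K) {α β : Fin r} (h : α < β) :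
    MvPowerSeries.C (deltaFactor s α β) ∈ serNonpos K β := by
  refine C_mem_coeffsIn (heval_mem_suppIn (zratioK_order_pos h) ?_ _)
  refine Subring.mul_mem _ (single_mem_suppIn (S := expNonpos β) (And.intro ?_ fun j hj => ?_) _)
    (single_mem_suppIn (S := expNonpos β) (And.intro ?_ fun j hj => ?_) _)
  · exact (Pi.single_eq_of_ne (M := fun _ => ℤ) h.ne' _).le
  · exact Pi.single_eq_of_ne (M := fun _ => ℤ) (h.trans hj).ne' _
  · change Pi.single (M := fun _ => ℤ) β (-1) β ≤ 0
    simp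
  · exact Pi.single_eq_of_ne (M := fun _ => ℤ) hj.ne' _

end Factors

/-! ### Evaluation at `t^{±ρ}` -/

section Specialization

variable {K : Type*} [Field K] {t th : K}

lemma pNegRho_mul (hth : th ^ 2 = t) (ht0 : t ≠ 0) {n : ℕ+} (hn : t ^ (n : ℕ) ≠ 1) :
    pNegRho th n * (1 - t ^ (n : ℕ)) = th ^ (n : ℕ) := by
  have h0 : th ^ (n : ℕ) ≠ 0 := pow_ne_zero _ (by rintro rfl; simp at hth; exact ht0 hth.symm)
  have h1 : t ^ (n : ℕ) = (th ^ (n : ℕ)) ^ 2 := by rw [← hth, ← pow_mul, ← pow_mul, mul_comm]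
  rw [h1] at hn ⊢
  have h2 : 1 - (th ^ (n : ℕ)) ^ 2 ≠ 0 := sub_ne_zero.mpr (Ne.symm hn)
  rw [pNegRho]
  have h3 : (th ^ (n : ℕ))⁻¹ - th ^ (n : ℕ) = (1 - (th ^ (n : ℕ)) ^ 2) / th ^ (n : ℕ) := by
    field_simp
  rw [h3]
  field_simp

lemma pRho_eq_neg (th : K) (n : ℕ+) : pRho th n = -pNegRho th n := by
  rw [pRho, pNegRho, ← neg_sub, one_div, one_div, inv_neg]

variable [CharZero K]

/-- The generating series satisfies `E(w) (1 - th w) = E(t w)`, so consecutive coefficients obey `(1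
- t^{r+1}) E_{r+1} = th E_r`. -/
lemma coeff_expSum_pRho (hth : th ^ 2 = t) (ht0 : t ≠ 0)
    (ht : ∀ n : ℕ, 0 < n → t ^ n ≠ 1) (r : ℕ) :
    PowerSeries.coeff r (expSum fun n => -(algebraMap ℚ K (1 / (n : ℚ)) * pRho th n)) *
      ∏ i ∈ Finset.range r, (1 - t ^ (i + 1)) = th ^ r := by
  set E := expSum fun n => -(algebraMap ℚ K (1 / (n : ℚ)) * pRho th n) with hE
  have hfun : E * (1 - PowerSeries.C th * PowerSeries.X) = PowerSeries.rescale t E := by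
    rw [hE, rescale_expSum, ← expSum_neg_log, ← expSum_add]
    congr 1
    funext n
    rw [Pi.add_apply, pRho_eq_neg]
    linear_combination algebraMap ℚ K (1 / (n : ℚ)) * pNegRho_mul hth ht0 (ht n n.pos)
  induction r with
  | zero => simp [hE, constantCoeff_expSum]
  | succ r ih =>
    have h := congrArg (PowerSeries.coeff (r + 1)) hfun
    rw [mul_sub, mul_one, ← mul_assoc, map_sub, PowerSeries.coeff_succ_mul_X,
      PowerSeries.coeff_mul_C, PowerSeries.coeff_rescale] at h
    rw [Finset.prod_range_succ, pow_succ th, ← ih]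
    linear_combination (∏ i ∈ Finset.range r, (1 - t ^ (i + 1))) * h

/-- At `t^{-ρ}`, `(1 - t^{-n}) p_n = -th^{-n}`, so each exponent is `log (1 - z_α / th)`. -/
lemma hmap_phiPlus {r : ℕ} (hth : th ^ 2 = t) (ht0 : t ≠ 0) (ht : ∀ n : ℕ, 0 < n → t ^ n ≠ 1) :
    hmap (MvPolynomial.eval (pNegRho th)) (phiPlus r t) =
      ∏ α : Fin r, (1 - HahnSeries.C th⁻¹ * zK K α 1) := by
  have hth0 : th ≠ 0 := by rintro rfl; simp at hth; exact ht0 hth.symm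
  rw [phiPlus, hexp_sum_heval _ _ _ fun α _ => zpw_order_pos α]
  refine Finset.prod_congr rfl fun α _ => ?_
  have h1 : (expSum fun n : ℕ+ => MvPolynomial.eval (pNegRho th)
      (MvPolynomial.C ((1 - (t ^ (n : ℕ))⁻¹) / (n : K)) * MvPolynomial.X n)) =
      1 - PowerSeries.C th⁻¹ * PowerSeries.X := by
    rw [← expSum_neg_log]
    congr 1
    funext n
    rw [map_mul, MvPolynomial.eval_C, MvPolynomial.eval_X, rat_inv_eq]
    have h2 := pNegRho_mul hth ht0 (ht n n.pos)
    have h3 : t ^ (n : ℕ) = (th ^ (n : ℕ)) ^ 2 := by rw [← hth, ← pow_mul, ← pow_mul, mul_comm]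
    have h4 : th ^ (n : ℕ) ≠ 0 := pow_ne_zero _ hth0
    have h5 : (n : K) ≠ 0 := by exact_mod_cast n.ne_zero
    rw [h3] at h2 ⊢
    rw [inv_pow]
    field_simp
    linear_combination (-1 : K) * h2
  have hpos : 0 < (zK K α 1).orderTop := by
    rw [← hmap_zpw (MvPolynomial.eval 0)]
    exact orderTop_hmap_pos _ (zpw_order_pos α)
  rw [h1, hmap_zpw, map_sub, map_mul, map_one, PowerSeries.heval_X _ hpos, PowerSeries.heval_C,
    HahnSeries.C_eq_algebraMap, Algebra.algebraMap_eq_smul_one]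

lemma algebraMap_rat_mvPowerSeries (x : ℚ) : algebraMap ℚ (MvPowerSeries ℕ+ K) x =
    MvPowerSeries.C (algebraMap ℚ K x) :=
  RingHom.congr_fun (Subsingleton.elim (algebraMap ℚ (MvPowerSeries ℕ+ K))
    (MvPowerSeries.C.comp (algebraMap ℚ K))) x

lemma expSum_pYNegRho_eq (hth : th ^ 2 = t) (ht0 : t ≠ 0) (ht : ∀ n : ℕ, 0 < n → t ^ n ≠ 1) :
    (expSum fun n => -(algebraMap ℚ (MvPowerSeries ℕ+ K) (1 / (n : ℚ)) * pYNegRho th n)) =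
      (1 - PowerSeries.C (MvPowerSeries.C th) * PowerSeries.X) *
        wtSeries (expLin fun n : ℕ+ => -((1 - t ^ (n : ℕ)) / (n : K))) *
        PowerSeries.rescale (MvPowerSeries.C t)
          (expSum fun n => -(algebraMap ℚ (MvPowerSeries ℕ+ K) (1 / (n : ℚ)) *
            pYNegRho th n)) := by
  rw [wtSeries_expLin, rescale_expSum, ← expSum_neg_log, ← expSum_add, ← expSum_add]
  congr 1
  funext n
  simp only [Pi.add_apply, pYNegRho, algebraMap_rat_mvPowerSeries, rat_inv_eq]
  have h2 := congrArg (MvPowerSeries.C (σ := ℕ+)) (pNegRho_mul hth ht0 (ht n n.pos))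
  rw [map_mul, map_sub, map_one, map_pow, map_pow] at h2
  rw [show -((1 - t ^ (n : ℕ)) / (n : K)) = -(1 / (n : K) * (1 - t ^ (n : ℕ))) by ring,
    map_neg, map_mul, map_sub, map_one, map_pow]
  linear_combination (-MvPowerSeries.C (1 / (n : K))) * h2

end Specialization

/-! ### The operator applied to the Cauchy kernel -/

section Assembly

variable {K : Type*} [Field K] [CharZero K] {r : ℕ}

lemma cauchyKernel_eq (q t : K) : cauchyKernel q t = expLin fun n : ℕ+ =>
    MvPolynomial.C (1 / (n : K) * ((1 - t ^ (n : ℕ)) / (1 - q ^ (n : ℕ)))) *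
      MvPolynomial.X n := rfl

/-- The specialization touches only coefficients, so it passes inside the constant term; `phiMinus`,
now a ring homomorphism, then acts on the whole series in `y`. -/
lemma specX_actX_H (q t th : K) (F : MvPowerSeries ℕ+ (SymF K)) :
    specX th (actX (H q t th r) F) = MvPowerSeries.C (elem (pRho th) r) *
      yConstTerm K r (MvPowerSeries.C (hmap (MvPolynomial.eval (pNegRho th)) (Delta r t⁻¹) *
          hmap (MvPolynomial.eval (pNegRho th)) (phiPlus r t)) *
        MvPowerSeries.map ((hmap (MvPolynomial.eval (pNegRho th))).comp (phiMinusHom r q)) F) := by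
  ext b
  rw [specX, MvPowerSeries.coeff_map, MvPowerSeries.coeff_C_mul, coeff_yConstTerm,
    MvPowerSeries.coeff_C_mul, MvPowerSeries.coeff_map, RingHom.comp_apply, ← map_mul, ← map_mul,
    coeff_hmap, mul_assoc, ← phiMinus_eq]
  change MvPolynomial.eval _ (H q t th r (MvPowerSeries.coeff b F)) = _
  rw [H, map_mul, MvPolynomial.eval_C]
  rfl

lemma expLin_atInv (α : Fin r) (c : ℕ+ → K) :
    expLin (fun n : ℕ+ => HahnSeries.C (c n) * zK K α (-1) ^ (n : ℕ)) = atInv α (expLin c) := by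
  rw [atInv, yConst, map_expLin, rescale_expLin]
  congr 1
  funext n
  rw [Pi.mul_apply, mul_comm]

lemma map_cauchyKernel (q t : K) (hq : ∀ n : ℕ, 0 < n → q ^ n ≠ 1) (th : K) :
    MvPowerSeries.map ((hmap (MvPolynomial.eval (pNegRho th))).comp (phiMinusHom r q))
        (cauchyKernel q t) =
      yConst K r (specX th (cauchyKernel q t)) *
        ∏ α : Fin r, atInv α (expLin fun n : ℕ+ => -((1 - t ^ (n : ℕ)) / (n : K))) := by
  rw [cauchyKernel_eq, map_expLin, specX, map_expLin, yConst, map_expLin]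
  simp only [← expLin_atInv]
  rw [← expLin_sum, ← expLin_add]
  congr 1
  funext n
  have hC : ∀ f : SymF K, hmap (MvPolynomial.eval (pNegRho th))
      (HahnSeries.C f : ZSeries K r) = HahnSeries.C (MvPolynomial.eval (pNegRho th) f) :=
    fun f => hmap_single _ _ _
  have hq' : 1 - q ^ (n : ℕ) ≠ 0 := sub_ne_zero.mpr (Ne.symm (hq n n.pos))
  have hz : hmap (MvPolynomial.eval (pNegRho th)) (∑ α : Fin r, zpw α (-1) ^ (n : ℕ)) =
      ∑ α : Fin r, zK K α (-1) ^ (n : ℕ) := by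
    rw [map_sum]
    simp only [map_pow, hmap_zpw]
  obtain ⟨κ, hκ⟩ : ∃ κ : K, κ = 1 / (n : K) * ((1 - t ^ (n : ℕ)) / (1 - q ^ (n : ℕ))) := ⟨_, rfl⟩
  -- The only place where `q` matters: the translation cancels the denominator of the kernel.
  have hc : -((1 - t ^ (n : ℕ)) / (n : K)) = κ * (q ^ (n : ℕ) - 1) := by
    rw [hκ]
    field_simp
    ring
  rw [← hκ, RingHom.comp_apply, phiMinusHom_C_mul_X, RingHom.map_mul (hmap _),
    RingHom.map_add (hmap _), RingHom.map_mul (hmap _), hz, hC, hC, hC, Pi.add_apply,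
    Finset.sum_apply, ← Finset.mul_sum, hc, MvPolynomial.eval_C, MvPolynomial.eval_C,
    RingHom.map_mul (MvPolynomial.eval _), MvPolynomial.eval_C, MvPolynomial.eval_X,
    ← hκ, RingHom.map_mul HahnSeries.C κ, RingHom.map_mul HahnSeries.C κ]
  ring

omit [CharZero K] in
lemma prod_range_inv_pow (t : K) (r : ℕ) :
    ∏ i ∈ Finset.range r, t⁻¹ ^ i = (t ^ (r * (r - 1) / 2))⁻¹ := by
  rw [Finset.prod_pow_eq_pow_sum, Finset.sum_range_id, inv_pow]

lemma yConstTerm_specialized {t th : K} (hth : th ^ 2 = t) (ht0 : t ≠ 0)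
    (ht : ∀ n : ℕ, 0 < n → t ^ n ≠ 1) (r : ℕ) :
    yConstTerm K r (MvPowerSeries.C (hmap (MvPolynomial.eval (pNegRho th)) (Delta r t⁻¹) *
          hmap (MvPolynomial.eval (pNegRho th)) (phiPlus r t)) *
        ∏ α : Fin r, atInv α (expLin fun n : ℕ+ => -((1 - t ^ (n : ℕ)) / (n : K)))) =
      MvPowerSeries.C ((-th⁻¹) ^ r * ∏ i ∈ Finset.range r, t⁻¹ ^ i * (1 - t ^ (i + 1))) *
        PowerSeries.coeff r (expSum fun n =>
          -(algebraMap ℚ (MvPowerSeries ℕ+ K) (1 / (n : ℚ)) * pYNegRho th n)) := by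
  have hth0 : th ≠ 0 := by rintro rfl; simp at hth; exact ht0 hth.symm
  have hyC : ∀ a : K, yConst K r (MvPowerSeries.C a) = MvPowerSeries.C (HahnSeries.C a) :=
    fun a => MvPowerSeries.map_C _ _
  -- Pulling out `-z_α / th` leaves a series in `1/z_α` times one explicit `z_α`, the shape that
  -- `yConstTerm_prod` requires.
  have hphi : ∀ α : Fin r, (MvPowerSeries.C (1 - HahnSeries.C th⁻¹ * zK K α 1) : YZ K r) =
      yConst K r (MvPowerSeries.C (-th⁻¹)) *
        (zY K α 1 * (1 - yConst K r (MvPowerSeries.C th) * zY K α (-1))) := by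
    intro α
    have h1 : (MvPowerSeries.C (HahnSeries.C th⁻¹) : YZ K r) *
        MvPowerSeries.C (HahnSeries.C th) = 1 := by
      rw [← map_mul, ← map_mul, inv_mul_cancel₀ hth0, map_one, map_one]
    have h2 := zY_one_mul_zY_neg_one (K := K) α
    rw [hyC, hyC, map_sub, map_mul, map_one, map_neg, map_neg]
    change 1 - _ * zY K α 1 = _
    linear_combination (-MvPowerSeries.C (HahnSeries.C th⁻¹) *
      MvPowerSeries.C (HahnSeries.C th)) * h2 - h1
  have hprod := yConstTerm_prod (r := r) (inv_mul_cancel₀ ht0)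
    (expLin fun n : ℕ+ => -((1 - t ^ (n : ℕ)) / (n : K))) (MvPowerSeries.C th)
    (fun i j => MvPowerSeries.C (deltaFactor t⁻¹ i j))
    (fun i j hij => deltaFactor_mem _ hij)
    (fun i j hij => by
      have h := congrArg (MvPowerSeries.C (σ := ℕ+)) (one_sub_mul_deltaFactor t⁻¹ hij)
      rw [map_mul, map_sub, map_sub, map_mul, map_one, zratioK, map_mul, ← mul_assoc, ← hyC] at h
      exact h)
    (constantCoeff_expSum _) (by rw [wtSeries_expLin, constantCoeff_expSum])
    (expSum_pYNegRho_eq hth ht0 ht)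
  rw [hmap_Delta _ (fun a => MvPolynomial.eval_C a), hmap_phiPlus hth ht0 ht,
    RingHom.map_mul MvPowerSeries.C, map_prod MvPowerSeries.C, map_prod MvPowerSeries.C,
    Finset.prod_congr rfl fun α _ => hphi α, Finset.prod_mul_distrib, Finset.prod_const,
    Finset.card_univ, Fintype.card_fin, ← map_pow, ← map_pow,
    RingHom.map_mul MvPowerSeries.C, mul_assoc (MvPowerSeries.C ((-th⁻¹) ^ r)), ← hprod,
    ← yConstTerm_mul]
  congr 1
  simp only [map_prod, Finset.prod_mul_distrib]
  ring

end Assembly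

end Mac

end

/-- `H^r(x) Π(x, y; q, t) / Π(x, y; q, t)` at `x = t^{-ρ}` equals
`(-1)^r t^{-r(r-1)/2} e_r(y, t^{-ρ})`, as formal power series in the power sums of `y`. -/
theorem proposition3p2 {K : Type*} [Field K] [CharZero K] (q t th : K) (hth : th ^ 2 = t)
    (ht0 : t ≠ 0) (ht : ∀ n : ℕ, 0 < n → t ^ n ≠ 1) (hq : ∀ n : ℕ, 0 < n → q ^ n ≠ 1) (r : ℕ) :
    Mac.specX th
        (Mac.actX (Mac.H q t th r) (Mac.cauchyKernel q t) * Mac.cauchyKernelInv q t) =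
      MvPowerSeries.C ((-1) ^ r * (t ^ (r * (r - 1) / 2))⁻¹) *
        Mac.elem (Mac.pYNegRho th) r := by
  have hth0 : th ≠ 0 := by rintro rfl; simp at hth; exact ht0 hth.symm
  have hinv : Mac.specX th (Mac.cauchyKernel q t) * Mac.specX th (Mac.cauchyKernelInv q t) = 1 := by
    rw [← map_mul, Mac.cauchyKernel_mul_inv, map_one]
  have he := Mac.coeff_expSum_pRho hth ht0 ht r
  rw [map_mul, Mac.specX_actX_H, Mac.map_cauchyKernel q t hq, mul_left_comm (MvPowerSeries.C _),
    Mac.yConstTerm_mul, Mac.yConstTerm_specialized hth ht0 ht, Mac.elem_eq (Mac.pYNegRho th)]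
  -- The prefactor `e_r(t^ρ)` cancels `∏ (1 - t^{i+1})` and the powers of `th`, signs included.
  have hscal : Mac.elem (Mac.pRho th) r *
      ((-th⁻¹) ^ r * ∏ i ∈ Finset.range r, t⁻¹ ^ i * (1 - t ^ (i + 1))) =
      (t ^ (r * (r - 1) / 2))⁻¹ := by
    rw [Mac.elem_eq, Finset.prod_mul_distrib, Mac.prod_range_inv_pow, neg_pow th⁻¹, inv_pow]
    have h1 : ((-1 : K) ^ r) * (-1) ^ r = 1 := by rw [← mul_pow]; simp
    have h2 : (th ^ r)⁻¹ * th ^ r = 1 := inv_mul_cancel₀ (pow_ne_zero _ hth0)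
    linear_combination (-1 : K) ^ r * (-1) ^ r * (th ^ r)⁻¹ * (t ^ (r * (r - 1) / 2))⁻¹ * he +
      (t ^ (r * (r - 1) / 2))⁻¹ * h1 + (-1 : K) ^ r * (-1) ^ r * (t ^ (r * (r - 1) / 2))⁻¹ * h2
  have hC := congrArg (MvPowerSeries.C (σ := ℕ+)) hscal
  rw [RingHom.map_mul MvPowerSeries.C] at hC
  have hsign : (MvPowerSeries.C ((-1 : K) ^ r) : MvPowerSeries ℕ+ K) * (-1) ^ r = 1 := by
    rw [map_pow, map_neg, map_one, ← mul_pow]; simp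
  rw [RingHom.map_mul MvPowerSeries.C ((-1) ^ r), ← hC]
  linear_combination MvPowerSeries.C (Mac.elem (Mac.pRho th) r) *
    MvPowerSeries.C ((-th⁻¹) ^ r * ∏ i ∈ Finset.range r, t⁻¹ ^ i * (1 - t ^ (i + 1))) *
    PowerSeries.coeff r (Mac.expSum fun n =>
      -(algebraMap ℚ (MvPowerSeries ℕ+ K) (1 / (n : ℚ)) * Mac.pYNegRho th n)) * (hinv - hsign)
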